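/- Let $(A,\mathfrak m,k)$ be a commutative Noetherian local ring and let $C\colon \cdots\to C_1\to C_0\xrightarrow{d_0} C_{-1}\to\cdots$ be a complex of finitely generated free $A$-modules which is totally acyclic ($C$ and $\operatorname{Hom}_A(C,A)$ are exact) and minimal (the image of $C_n\to C_{n-1}$ lies in $\mathfrak m C_{n-1}$ for all $n\in\mathbb Z$). Put $M=\operatorname{Im} d_0$ and $M^*=\operatorname{Hom}_A(M,A)$. Let $D^b(A)$ be the bounded derived category of finitely generated $A$-modules, with suspension $\Sigma$, and write $\operatorname{Ext}^n_A(X,Y)=\operatorname{Hom}_{D^b(A)}(X,\Sigma^nY)$ and $\operatorname{Ext}_A(X,Y)=\bigoplus_{n\in\mathbb Z}\operatorname{Ext}^n_A(X,Y)$. Let $H=\bigoplus_{n\ge 0}H_n$ be a graded ring with $\eta\theta=(-1)^{|\eta||\theta|}\theta\eta$ for homogeneous $\eta,\theta$, and let $H\to Z(D^b(A))$ be a homomorphism of graded rings to the graded center, whose degree $n$ part consists of the natural transformations $f\colon\mathrm{Id}\to\Sigma^n$ with $f_{\Sigma X}=(-1)^n\Sigma f_X$. Let $\varphi_X\colon H\to\operatorname{Ext}_A(X,X)$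 be the induced ring homomorphisms; $H$ acts on $\operatorname{Ext}_A(X,Y)$ by $\eta\cdot\theta=\varphi_Y(\eta)\circ\theta$. Assume: (1) there is an integer $n_0$ such that the $H$-module $\bigoplus_{n\ge n_0}\operatorname{Ext}^n_A(M\oplus M^*,k)$ is Noetherian and $\operatorname{Ext}^n_A(M\oplus M^*,k)$ has finite length over $H_0$ for every $n\ge n_0$; (2) $\mathcal D(\varphi_M(\eta))=\varphi_{M^*}(\eta)$ for every homogeneous $\eta\in H$, where $\mathcal D\colon\operatorname{Ext}_A(M,M)\to\operatorname{Ext}_A(M^*,M^*)$ sends the element corresponding to a chain map $C\to\Sigma^nC$ to the element corresponding to the transposed chain map $C^*\to\Sigma^n(C^*)$, with $C^*=\operatorname{Hom}_A(C,A)$. Then $C$ has symmetric growth: $\operatorname{cx}^+_AM=\operatorname{cx}^-_AM$ in $\{0,1,2,\dots\}\cup\{\infty\}$, where $\operatorname{cx}^+_AM$ (respectively $\operatorname{cx}^-_AM$) is the infimum of the integers $t\ge 0$ for which there is $a\in\mathbb R$ with $\operatorname{rank}C_n\le a\,n^{t-1}$ for all $n\gg0$ (respectively $\operatorname{rank}C_n\le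 a\,(-n)^{t-1}$ for all $n\ll0$). -/

import Mathlib

open CategoryTheory DirectSum

universe v u w w'

set_option linter.unusedSectionVars false

noncomputable section

/-! ### The graded center of a category with shift, and central actions of graded rings -/

section Center

variable (T : Type w) [Category.{w'} T] [Preadditive T] [HasShift T ℤ]
  [∀ n : ℤ, (shiftFunctor T n).Additive]

/-- The degree `n` component of the graded center: natural transformations `f : Id ⟶ Σⁿ` such that
`f_{ΣX} = (-1)ⁿ Σ f_X` (under the canonical identification `Σ Σⁿ X = Σⁿ Σ X`). -/
def gradedCenter (n : ℤ) : AddSubgroup (∀ X : T, ShiftedHom X X n) where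
  carrier := {z | (∀ (X Y : T) (f : X ⟶ Y), f ≫ z Y = z X ≫ f⟦n⟧') ∧
    ∀ X : T, z (X⟦(1 : ℤ)⟧) = n.negOnePow • ((z X)⟦(1 : ℤ)⟧' ≫ (shiftComm X n 1).hom)}
  zero_mem' := by
    refine ⟨fun X Y f => ?_, fun X => ?_⟩ <;> simp
  add_mem' := by
    rintro a b ⟨ha, ha'⟩ ⟨hb, hb'⟩
    refine ⟨fun X Y f => ?_, fun X => ?_⟩
    · simp [ha, hb]
    · simp [ha', hb', smul_add]
  neg_mem' := by
    rintro a ⟨ha, ha'⟩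
    refine ⟨fun X Y f => ?_, fun X => ?_⟩
    · simp [ha]
    · simp [ha', smul_neg]

/-- An action of the graded ring `H = ⨁_{n ≥ 0} 𝒜 n` on `T` that is central: a homomorphism of
graded rings from `H` to the graded center of `T`. The product of `a` and `b` in the graded center
is, at the object `X`, the composite `X ⟶ Σⁿ X ⟶ Σⁿ Σᵐ X` of `b_X` and `Σⁿ a_X`
(`m = |a|`, `n = |b|`), and the unit is the identity of the identity functor. -/
structure CentralAction {H : Type v} [Ring H] (𝒜 : ℕ → AddSubgroup H) [GradedRing 𝒜] where
  /-- the homogeneous components of the homomorphism -/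
  toCenter : ∀ n : ℕ, 𝒜 n →+ gradedCenter T (n : ℤ)
  map_one : ∀ X : T,
    (toCenter 0 ⟨1, SetLike.GradedOne.one_mem⟩ : ∀ X : T, ShiftedHom X X ((0 : ℕ) : ℤ)) X =
      ShiftedHom.mk₀ _ Nat.cast_zero (𝟙 X)
  map_mul : ∀ (m n : ℕ) (a : 𝒜 m) (b : 𝒜 n) (X : T),
    (toCenter (m + n) ⟨a * b, SetLike.GradedMul.mul_mem a.2 b.2⟩ :
        ∀ X : T, ShiftedHom X X ((m + n : ℕ) : ℤ)) X =
      ShiftedHom.comp ((toCenter n b).1 X) ((toCenter m a).1 X) (Nat.cast_add m n).symm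

end Center

namespace CentralAction

variable {T : Type w} [Category.{w'} T] [Preadditive T] [HasShift T ℤ]
  [∀ n : ℤ, (shiftFunctor T n).Additive]
  {H : Type v} [Ring H] {𝒜 : ℕ → AddSubgroup H} [GradedRing 𝒜]
  (act : CentralAction T 𝒜)

/-- The components `𝒜 n → Extⁿ(X, X) = Hom(X, Σⁿ X)` of the ring homomorphism `φ_X`. -/
def φ (X : T) (n : ℕ) : 𝒜 n →+ ShiftedHom X X (n : ℤ) :=
  (Pi.evalAddMonoidHom (fun X : T => ShiftedHom X X (n : ℤ)) X).comp
    ((gradedCenter T (n : ℤ)).subtype.comp (act.toCenter n))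

lemma φ_one (X : T) : act.φ X 0 ⟨1, SetLike.GradedOne.one_mem⟩ =
    ShiftedHom.mk₀ _ Nat.cast_zero (𝟙 X) := act.map_one X

lemma φ_mul (X : T) (m n : ℕ) (a : 𝒜 m) (b : 𝒜 n) :
    act.φ X (m + n) ⟨a * b, SetLike.GradedMul.mul_mem a.2 b.2⟩ =
      ShiftedHom.comp (act.φ X n b) (act.φ X m a) (Nat.cast_add m n).symm := act.map_mul m n a b X

/-- Yoneda composition with `φ_Y(a)` in degrees `j → c`. -/
def smulHom (X Y : T) (m : ℕ) (j c : ℤ) (h : (m : ℤ) + j = c) :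
    𝒜 m →+ ShiftedHom X Y j →+ ShiftedHom X Y c :=
  AddMonoidHom.mk' (fun a => AddMonoidHom.mk' (fun x => x.comp (act.φ Y m a) h)
    (fun x y => by simp)) (fun a b => by ext x; simp)

lemma smulHom_apply (X Y : T) (m : ℕ) (j c : ℤ) (h : (m : ℤ) + j = c) (a : 𝒜 m)
    (x : ShiftedHom X Y j) : act.smulHom X Y m j c h a x = x.comp (act.φ Y m a) h := rfl

lemma smulHom_one (X Y : T) (j : ℤ) (h : ((0 : ℕ) : ℤ) + j = j) (x : ShiftedHom X Y j) :
    act.smulHom X Y 0 j j h ⟨1, SetLike.GradedOne.one_mem⟩ x = x := by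
  rw [smulHom_apply, φ_one, ShiftedHom.comp_mk₀_id]

lemma smulHom_mul (X Y : T) (m n : ℕ) (j c d : ℤ) (hc : (n : ℤ) + j = c) (hd : (m : ℤ) + c = d)
    (hd' : ((m + n : ℕ) : ℤ) + j = d) (a : 𝒜 m) (b : 𝒜 n) (x : ShiftedHom X Y j) :
    act.smulHom X Y (m + n) j d hd' ⟨a * b, SetLike.GradedMul.mul_mem a.2 b.2⟩ x =
      act.smulHom X Y m c d hd a (act.smulHom X Y n j c hc b x) := by
  simp only [smulHom_apply]
  rw [φ_mul, ← ShiftedHom.comp_assoc x _ _ hc _ (by push_cast at hd'; omega)]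

/-- The graded `H`-module `Ext(X, Y) = ⨁_{n ∈ ℤ} Hom(X, Σⁿ Y)`. -/
@[nolint unusedArguments]
def Ext (_act : CentralAction T 𝒜) (X Y : T) : Type w' := ⨁ n : ℤ, ShiftedHom X Y n

instance (X Y : T) : AddCommGroup (act.Ext X Y) :=
  inferInstanceAs (AddCommGroup (⨁ n : ℤ, ShiftedHom X Y n))

/-- The inclusion of the homogeneous elements of degree `n`. -/
def ofDegree (X Y : T) (n : ℤ) : ShiftedHom X Y n →+ act.Ext X Y :=
  DirectSum.of (fun n : ℤ => ShiftedHom X Y n) n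

/-- The homogeneous component of degree `n`. -/
def component (X Y : T) (n : ℤ) : act.Ext X Y →+ ShiftedHom X Y n :=
  DFinsupp.evalAddMonoidHom (β := fun n : ℤ => ShiftedHom X Y n) n

/-- The action of a homogeneous element of degree `m` on `Ext(X, Y)`. -/
def actElement (X Y : T) (m : ℕ) (a : 𝒜 m) : act.Ext X Y →+ act.Ext X Y :=
  DirectSum.toAddMonoid (β := fun n : ℤ => ShiftedHom X Y n)
    (fun j => (act.ofDegree X Y (m + j)).comp (act.smulHom X Y m j _ rfl a))

lemma actElement_ofDegree (X Y : T) (m : ℕ) (a : 𝒜 m) (j : ℤ) (x : ShiftedHom X Y j) :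
    act.actElement X Y m a (act.ofDegree X Y j x) =
      act.ofDegree X Y (m + j) (act.smulHom X Y m j _ rfl a x) :=
  DirectSum.toAddMonoid_of _ _ _

lemma end_ext (X Y : T) {f g : AddMonoid.End (act.Ext X Y)}
    (h : ∀ j (x : ShiftedHom X Y j), f (act.ofDegree X Y j x) = g (act.ofDegree X Y j x)) :
    f = g :=
  DirectSum.addHom_ext (β := fun n : ℤ => ShiftedHom X Y n) h

/-- The action of homogeneous elements of degree `m` on `Ext(X, Y)`, additively. -/
def actDegree (X Y : T) (m : ℕ) : 𝒜 m →+ AddMonoid.End (act.Ext X Y) :=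
  AddMonoidHom.mk' (act.actElement X Y m) (fun a b => act.end_ext X Y (fun j x => by
    change act.actElement X Y m (a + b) (act.ofDegree X Y j x) =
      act.actElement X Y m a (act.ofDegree X Y j x) +
        act.actElement X Y m b (act.ofDegree X Y j x)
    simp only [actElement_ofDegree, map_add, AddMonoidHom.add_apply]))

lemma actDegree_ofDegree (X Y : T) (m : ℕ) (j c : ℤ) (h : (m : ℤ) + j = c) (a : 𝒜 m)
    (x : ShiftedHom X Y j) : act.actDegree X Y m a (act.ofDegree X Y j x) =
      act.ofDegree X Y c (act.smulHom X Y m j c h a x) := by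
  subst h
  exact DirectSum.toAddMonoid_of _ _ _

/-- The action of `H` on `Ext(X, Y)`, as a map. -/
def actHom (X Y : T) : H →+ AddMonoid.End (act.Ext X Y) :=
  (DirectSum.toAddMonoid (act.actDegree X Y)).comp
    (DirectSum.decomposeAddEquiv 𝒜).toAddMonoidHom

lemma actHom_coe (X Y : T) (m : ℕ) (a : 𝒜 m) :
    act.actHom X Y (a : H) = act.actDegree X Y m a := by
  simp [actHom]

/-- The ring homomorphism `H → End(Ext(X, Y))` that defines the module structure. -/
def actRingHom (X Y : T) : H →+* AddMonoid.End (act.Ext X Y) where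
  toFun := act.actHom X Y
  map_zero' := map_zero _
  map_add' := map_add _
  map_one' := by
    refine act.end_ext X Y (fun j x => ?_)
    have := act.actHom_coe X Y 0 ⟨1, SetLike.GradedOne.one_mem⟩
    dsimp only at this
    rw [this, act.actDegree_ofDegree X Y 0 j j (by simp), smulHom_one]
    rfl
  map_mul' a b := by
    induction a using DirectSum.Decomposition.inductionOn 𝒜 with
    | zero => simp
    | add a a' ha ha' => simp [add_mul, ha, ha']
    | homogeneous a =>
      rename_i m
      induction b using DirectSum.Decomposition.inductionOn 𝒜 with
      | zero => simp
      | add b b' hb hb' => simp [mul_add, hb, hb']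
      | homogeneous b =>
        rename_i n
        refine act.end_ext X Y (fun j x => ?_)
        have := act.actHom_coe X Y (m + n) ⟨a * b, SetLike.GradedMul.mul_mem a.2 b.2⟩
        dsimp only at this
        rw [this, actHom_coe, actHom_coe]
        change act.actDegree X Y (m + n) ⟨a * b, SetLike.GradedMul.mul_mem a.2 b.2⟩ _ =
          act.actDegree X Y m a (act.actDegree X Y n b (act.ofDegree X Y j x))
        rw [
          act.actDegree_ofDegree X Y n j _ rfl, act.actDegree_ofDegree X Y m _ _ rfl,
          act.actDegree_ofDegree X Y (m + n) j (m + (n + j)) (by push_cast; ring),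
          act.smulHom_mul X Y m n j _ _ rfl rfl]

/-- The (left) `H`-module structure on `Ext(X, Y)`: for homogeneous `a` of degree `m` and
`x : X ⟶ Σʲ Y`, the product `a • x` is the composite `φ_Y(a) ∘ x : X ⟶ Σʲ⁺ᵐ Y`. -/
instance (X Y : T) : Module H (act.Ext X Y) := Module.compHom _ (act.actRingHom X Y)

lemma smul_ofDegree (X Y : T) (m : ℕ) (j c : ℤ) (h : (m : ℤ) + j = c) (a : 𝒜 m)
    (x : ShiftedHom X Y j) : (a : H) • act.ofDegree X Y j x =
      act.ofDegree X Y c (x.comp (act.φ Y m a) h) := by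
  change act.actHom X Y (a : H) (act.ofDegree X Y j x) = _
  rw [actHom_coe, act.actDegree_ofDegree X Y m j c h]
  rfl

lemma component_ofDegree_of_ne (X Y : T) (n j : ℤ) (h : j ≠ n) (x : ShiftedHom X Y j) :
    act.component X Y n (act.ofDegree X Y j x) = 0 :=
  DirectSum.of_eq_of_ne (β := fun n : ℤ => ShiftedHom X Y n) j n x h.symm

/-- The `H`-submodule `Ext^{≥ n₀}(X, Y) = ⨁_{n ≥ n₀} Hom(X, Σⁿ Y)` of `Ext(X, Y)`. -/
def extGE (X Y : T) (n₀ : ℤ) : Submodule H (act.Ext X Y) where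
  carrier := {x | ∀ n < n₀, act.component X Y n x = 0}
  zero_mem' := fun n _ => map_zero _
  add_mem' := by
    intro x y hx hy n hn
    rw [map_add, hx n hn, hy n hn, add_zero]
  smul_mem' := by
    intro a x hx n hn
    classical
    have hsum : x = ∑ i ∈ DFinsupp.support (β := fun n : ℤ => ShiftedHom X Y n) x,
        act.ofDegree X Y i (act.component X Y i x) :=
      (DirectSum.sum_support_of (β := fun n : ℤ => ShiftedHom X Y n) x).symm
    induction a using DirectSum.Decomposition.inductionOn 𝒜 with
    | zero => simp
    | add a a' ha ha' => rw [add_smul, map_add, ha, ha', add_zero]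
    | homogeneous a =>
      rename_i m
      rw [hsum, Finset.smul_sum, map_sum]
      refine Finset.sum_eq_zero (fun i _ => ?_)
      rw [act.smul_ofDegree X Y m i _ rfl]
      by_cases hi : i < n₀
      · rw [hx i hi, ShiftedHom.zero_comp, map_zero, map_zero]
      · exact act.component_ofDegree_of_ne X Y n _ (by omega) _

/-- The homogeneous component `Extⁿ(X, Y) = Hom(X, Σⁿ Y)`, as a module over `H₀ = 𝒜 0`. -/
@[nolint unusedArguments]
def ExtDegree (_act : CentralAction T 𝒜) (X Y : T) (n : ℤ) : Type w' := ShiftedHom X Y n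

instance (X Y : T) (n : ℤ) : AddCommGroup (act.ExtDegree X Y n) :=
  inferInstanceAs (AddCommGroup (ShiftedHom X Y n))

/-- The ring homomorphism `H₀ → End(Extⁿ(X, Y))`. -/
def actRingHomZero (X Y : T) (n : ℤ) : 𝒜 0 →+* AddMonoid.End (act.ExtDegree X Y n) where
  toFun := act.smulHom X Y 0 n n (by simp)
  map_zero' := map_zero _
  map_add' := map_add _
  map_one' := by
    ext x
    exact act.smulHom_one X Y n _ x
  map_mul' a b := by
    ext x
    exact act.smulHom_mul X Y 0 0 n n n _ _ (by simp) a b x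

/-- The `H₀`-module structure on `Extⁿ(X, Y)`: the product `a • x` is `φ_Y(a) ∘ x`. -/
instance (X Y : T) (n : ℤ) : Module (𝒜 0) (act.ExtDegree X Y n) :=
  Module.compHom _ (act.actRingHomZero X Y n)

/-- `Ext(X, Y)` is an eventually Noetherian `H`-module of finite length: for some `n₀`, the
`H`-module `Ext^{≥ n₀}(X, Y)` is Noetherian, and `Extⁿ(X, Y)` has finite length over `H₀` for all
`n ≥ n₀`. -/
def NoethFl (X Y : T) : Prop :=
  ∃ n₀ : ℤ, IsNoetherian H (act.extGE X Y n₀) ∧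
    ∀ n ≥ n₀, IsFiniteLength (𝒜 0) (act.ExtDegree X Y n)

end CentralAction

/-! ### Complexes of finitely generated free modules over a local ring -/

section Complexes

variable {A : Type u} [CommRing A]

/-- The linear map underlying a differential of a complex of finitely generated modules. -/
abbrev diffMap (C : CochainComplex (FGModuleCat.{u} A) ℤ) (i j : ℤ) : C.X i →ₗ[A] C.X j :=
  (C.d i j).hom.hom

lemma diffMap_comp_apply (C : CochainComplex (FGModuleCat.{u} A) ℤ) (i j k : ℤ) (x : C.X i) :
    diffMap C j k (diffMap C i j x) = 0 := by
  have h := congrArg (fun f => f.hom.hom x) (C.d_comp_d i j k)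
  exact h

/-- A complex `C` of finitely generated free modules is totally acyclic if both `C` and
`Hom(C, A)` are exact. (Complexes are written with cohomological indexing, that is, `C.X i` is the
module usually written `C_{-i}`, and `C.d i (i + 1)` is the differential `C_{-i} ⟶ C_{-i-1}`.) -/
structure IsTotallyAcyclic (C : CochainComplex (FGModuleCat.{u} A) ℤ) : Prop where
  free : ∀ i, Module.Free A (C.X i)
  exact : ∀ i, Function.Exact (diffMap C (i - 1) i) (diffMap C i (i + 1))
  exact_dual : ∀ i, Function.Exact (diffMap C i (i + 1)).dualMap (diffMap C (i - 1) i).dualMap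

/-- A complex of free modules over a local ring is minimal if the image of each differential
`C_n ⟶ C_{n-1}` is contained in `𝔪 C_{n-1}`. -/
def IsMinimalComplex [IsLocalRing A] (C : CochainComplex (FGModuleCat.{u} A) ℤ) : Prop :=
  ∀ i, LinearMap.range (diffMap C i (i + 1)) ≤
    IsLocalRing.maximalIdeal A • (⊤ : Submodule A (C.X (i + 1)))

/-- The module `M_C`, the image of the zeroth differential `C_0 ⟶ C_{-1}`. -/
abbrev imageZero (C : CochainComplex (FGModuleCat.{u} A) ℤ) : Submodule A (C.X 1) :=
  LinearMap.range (diffMap C 0 1)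

instance finite_dual [IsNoetherianRing A] (N : Type u) [AddCommGroup N] [Module A N] [Module.Finite A N] :
    Module.Finite A (Module.Dual A N) :=
  inferInstanceAs (Module.Finite A (N →ₗ[A] A))

variable [IsNoetherianRing A]

/-- The dual complex `C^* = Hom(C, A)`, with the transposed differentials. -/
def dualComplex (C : CochainComplex (FGModuleCat.{u} A) ℤ) :
    CochainComplex (FGModuleCat.{u} A) ℤ where
  X i := FGModuleCat.of A (Module.Dual A (C.X (-i)))
  d i j := FGModuleCat.ofHom (diffMap C (-j) (-i)).dualMap
  shape i j hij := by
    have h : C.d (-j) (-i) = 0 := C.shape _ _ (by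
      simp only [ComplexShape.up_Rel] at hij ⊢
      omega)
    change FGModuleCat.ofHom (C.d (-j) (-i)).hom.hom.dualMap = 0
    rw [h]
    ext f x
    exact map_zero f
  d_comp_d' i j k _ _ := by
    ext f x
    change f (diffMap C (-j) (-i) (diffMap C (-k) (-j) x)) = 0
    rw [diffMap_comp_apply, map_zero]

open CochainComplex.HomComplex in
/-- The transpose of a chain map `C ⟶ Σⁿ C`, a chain map `C^* ⟶ Σⁿ C^*`. Chain maps to `Σⁿ C` are
given as cocycles of degree `n` in the complex `Hom(C, C)`, that is, as families of maps
`C.X p ⟶ C.X (p + n)` which commute with the differentials up to the sign `(-1)ⁿ`. -/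
def dualCocycle {C : CochainComplex (FGModuleCat.{u} A) ℤ} {n : ℤ} (F : Cocycle C C n) :
    Cocycle (dualComplex C) (dualComplex C) n :=
  Cocycle.mk (Cochain.mk (fun p q hpq => FGModuleCat.ofHom
    (F.1.v (-q) (-p) (by omega)).hom.hom.dualMap)) (n + 1) rfl (by
      refine Cochain.ext _ _ fun p q hpq => ?_
      have h := Cochain.congr_v (F.δ_eq_zero (n + 1)) (-q) (-p) (by omega)
      rw [δ_v n (n + 1) rfl _ (-q) (-p) (by omega) (-(p + 1)) (-(q - 1)) (by omega)
        (by omega)] at h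
      rw [δ_v n (n + 1) rfl _ p q hpq (q - 1) (p + 1) rfl rfl]
      ext f
      refine LinearMap.ext (M := C.X (-q)) (M₃ := A) fun x => ?_
      have hx := congrArg (fun g => (show Module.Dual A (C.X (-p)) from f) (g.hom.hom x)) h
      rcases Int.even_or_odd (n + 1) with hn | hn
      · rw [Int.negOnePow_even _ hn, one_smul] at hx ⊢
        refine Eq.trans ?_ (hx.trans (map_zero (show Module.Dual A (C.X (-p)) from f)))
        refine Eq.trans ?_ (map_add (show Module.Dual A (C.X (-p)) from f) _ _).symm
        exact add_comm _ _
      · rw [Int.negOnePow_odd _ hn, Units.neg_smul, one_smul] at hx ⊢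
        have hx' := (map_sub (show Module.Dual A (C.X (-p)) from f) _ _).symm.trans ((congrArg (show Module.Dual A (C.X (-p)) from f) (sub_eq_add_neg _ _)).trans
          (hx.trans (map_zero (show Module.Dual A (C.X (-p)) from f))))
        rw [sub_eq_zero] at hx'
        refine (sub_eq_add_neg _ _).symm.trans (sub_eq_zero.2 hx'.symm))

/-- The module `M_C` as an object of the category of finitely generated `A`-modules. -/
def moduleOf (C : CochainComplex (FGModuleCat.{u} A) ℤ) : FGModuleCat.{u} A :=
  FGModuleCat.of A (imageZero C)

/-- The dual module `M_C^* = Hom(M_C, A)`. -/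
def dualModuleOf (C : CochainComplex (FGModuleCat.{u} A) ℤ) : FGModuleCat.{u} A :=
  FGModuleCat.of A (Module.Dual A (imageZero C))

/-- The surjection `C_0 ⟶ M_C` induced by the zeroth differential. -/
def augmentation (C : CochainComplex (FGModuleCat.{u} A) ℤ) : C.X 0 ⟶ moduleOf C :=
  FGModuleCat.ofHom (diffMap C 0 1).rangeRestrict

/-- The map `(C_{-1})^* ⟶ M_C^*`, restriction of linear forms to `M_C`. -/
def dualAugmentation (C : CochainComplex (FGModuleCat.{u} A) ℤ) :
    (dualComplex C).X (-1) ⟶ dualModuleOf C :=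
  FGModuleCat.ofHom (V := Module.Dual A (C.X 1)) (imageZero C).subtype.dualMap

/-- Finitely generated free modules are projective objects. -/
lemma projective_of_free (N : FGModuleCat.{u} A) [Module.Free A N] : Projective N where
  factors {E X} f e he := by
    have : Epi ((forget₂ (FGModuleCat.{u} A) (ModuleCat.{u} A)).map e) := inferInstance
    have hs : Function.Surjective e.hom.hom := (ModuleCat.epi_iff_surjective _).1 this
    obtain ⟨g, hg⟩ := Module.projective_lifting_property e.hom.hom f.hom.hom hs
    refine ⟨FGModuleCat.ofHom g, ?_⟩
    ext x
    exact LinearMap.congr_fun hg x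

lemma exact_of_function_exact (S : ShortComplex (FGModuleCat.{u} A))
    (h : Function.Exact S.f.hom.hom S.g.hom.hom) : S.Exact := by
  rw [← S.exact_map_iff_of_faithful (forget₂ (FGModuleCat.{u} A) (ModuleCat.{u} A))]
  exact (ShortComplex.ShortExact.moduleCat_exact_iff_function_exact _).2 h

/-- The part `⋯ ⟶ E.X (q - 2) ⟶ E.X (q - 1) ⟶ E.X q` of a complex, as a chain complex. -/
def leftPart (E : CochainComplex (FGModuleCat.{u} A) ℤ) (q : ℤ) :
    ChainComplex (FGModuleCat.{u} A) ℕ where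
  X i := E.X (q - i)
  d i j := E.d (q - i) (q - j)
  shape i j hij := E.shape _ _ (by
    simp only [ComplexShape.up_Rel, ComplexShape.down_Rel] at hij ⊢
    omega)
  d_comp_d' i j k _ _ := E.d_comp_d _ _ _

/-- `ε : E.X q ⟶ N` makes `⋯ ⟶ E.X (q - 1) ⟶ E.X q ⟶ N ⟶ 0` a resolution by free modules. -/
structure IsFreeAugmentation (E : CochainComplex (FGModuleCat.{u} A) ℤ) (q : ℤ)
    {N : FGModuleCat.{u} A} (ε : E.X q ⟶ N) : Prop where
  free : ∀ i, Module.Free A (E.X i)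
  exact : ∀ i, Function.Exact (diffMap E (i - 1) i) (diffMap E i (i + 1))
  exact_aug : Function.Exact (diffMap E (q - 1) q) ε.hom.hom
  surjective : Function.Surjective ε.hom.hom

/-- The map `ε`, on the term of degree `0` of the chain complex `leftPart E q`. -/
def leftAugmentation {E : CochainComplex (FGModuleCat.{u} A) ℤ} {q : ℤ} {N : FGModuleCat.{u} A}
    (ε : E.X q ⟶ N) : (leftPart E q).X 0 ⟶ N :=
  (E.XIsoOfEq (show q - ((0 : ℕ) : ℤ) = q by simp)).hom ≫ ε

namespace IsFreeAugmentation

variable {E : CochainComplex (FGModuleCat.{u} A) ℤ} {q : ℤ} {N : FGModuleCat.{u} A}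
  {ε : E.X q ⟶ N}

lemma d_comp (h : IsFreeAugmentation E q ε) : E.d (q - 1) q ≫ ε = 0 := by
  ext x
  exact h.exact_aug.apply_apply_eq_zero x

lemma exact_of_eq (h : IsFreeAugmentation E q ε) (r p : ℤ) (hr : r = q - 1) (hp : p = q) :
    Function.Exact (diffMap E r p) ((E.XIsoOfEq hp).hom ≫ ε).hom.hom ∧
      Function.Surjective ((E.XIsoOfEq hp).hom ≫ ε).hom.hom := by
  subst hp hr
  rw [HomologicalComplex.XIsoOfEq_rfl, Iso.refl_hom, Category.id_comp]
  exact ⟨h.exact_aug, h.surjective⟩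

lemma exact_left (h : IsFreeAugmentation E q ε) :
    Function.Exact ((leftPart E q).d 1 0).hom.hom (leftAugmentation ε).hom.hom :=
  (h.exact_of_eq _ _ (by simp) _).1

lemma surjective_left (h : IsFreeAugmentation E q ε) :
    Function.Surjective (leftAugmentation ε).hom.hom :=
  (h.exact_of_eq _ _ rfl _).2

lemma d_comp_left (h : IsFreeAugmentation E q ε) :
    (leftPart E q).d 1 0 ≫ leftAugmentation ε = 0 := by
  ext x
  exact h.exact_left.apply_apply_eq_zero x

lemma exact_of_eq' (h : IsFreeAugmentation E q ε) (i j k : ℤ) (hi : i = j - 1) (hk : k = j + 1) :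
    Function.Exact (diffMap E i j) (diffMap E j k) := by
  subst hi hk
  exact h.exact j

lemma quasiIso (h : IsFreeAugmentation E q ε) :
    QuasiIso ((ChainComplex.toSingle₀Equiv (leftPart E q) N).symm
      ⟨leftAugmentation ε, h.d_comp_left⟩) where
  quasiIsoAt n := by
    cases n with
    | zero =>
      rw [ChainComplex.quasiIsoAt₀_iff, ShortComplex.quasiIso_iff_of_zeros']
      · have he : Epi (leftAugmentation ε) := by
          have : Epi ((forget₂ (FGModuleCat.{u} A) (ModuleCat.{u} A)).map (leftAugmentation ε)) :=
            (ModuleCat.epi_iff_surjective _).2 h.surjective_left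
          exact (forget₂ (FGModuleCat.{u} A) (ModuleCat.{u} A)).epi_of_epi_map this
        have hx := exact_of_function_exact
          (ShortComplex.mk ((leftPart E q).d 1 0) (leftAugmentation ε) h.d_comp_left) h.exact_left
        refine (ShortComplex.exact_and_epi_g_iff_of_iso ?_).2 ⟨hx, he⟩
        exact ShortComplex.isoMk (Iso.refl _) (Iso.refl _) (Iso.refl _)
          (by simp only [Iso.refl_hom]
              exact (Category.id_comp _).trans (Category.comp_id _).symm)
          (by simp only [Iso.refl_hom]
              exact (Category.id_comp _).trans (Category.comp_id _).symm)
      · exact (leftPart E q).shape 0 0 (by simp)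
      all_goals rfl
    | succ n =>
      rw [quasiIsoAt_iff_exactAt' _ _ (ChainComplex.exactAt_succ_single_obj _ _),
        HomologicalComplex.exactAt_iff' _ (n + 2) (n + 1) n (by simp) (by simp)]
      exact exact_of_function_exact _ (h.exact_of_eq' _ _ _ (by push_cast; ring)
        (by push_cast; ring))

/-- The resolution `⋯ ⟶ E.X (q - 1) ⟶ E.X q ⟶ N ⟶ 0` of `N`. -/
def resolution (h : IsFreeAugmentation E q ε) : ProjectiveResolution N where
  complex := leftPart E q
  projective n := by
    have := h.free (q - n)
    exact projective_of_free (E.X (q - n))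
  π := (ChainComplex.toSingle₀Equiv (leftPart E q) N).symm ⟨leftAugmentation ε, h.d_comp_left⟩
  quasiIso := h.quasiIso

end IsFreeAugmentation

/-- For a totally acyclic complex `C`, the modules `⋯ ⟶ C_1 ⟶ C_0` form a resolution of `M_C`. -/
lemma IsTotallyAcyclic.isFreeAugmentation {C : CochainComplex (FGModuleCat.{u} A) ℤ}
    (hC : IsTotallyAcyclic C) : IsFreeAugmentation C 0 (augmentation C) where
  free := hC.free
  exact := hC.exact
  exact_aug x := by
    have := hC.exact 0 x
    refine Iff.trans ?_ this
    exact Subtype.ext_iff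
  surjective := LinearMap.surjective_rangeRestrict _

lemma IsTotallyAcyclic.exact_dual_of_eq {C : CochainComplex (FGModuleCat.{u} A) ℤ}
    (hC : IsTotallyAcyclic C) (i j k : ℤ) (hi : i = j - 1) (hk : k = j + 1) :
    Function.Exact (diffMap C j k).dualMap (diffMap C i j).dualMap := by
  subst hi hk
  exact hC.exact_dual j

lemma IsTotallyAcyclic.exact_of_eq {C : CochainComplex (FGModuleCat.{u} A) ℤ}
    (hC : IsTotallyAcyclic C) (i j k : ℤ) (hi : i = j - 1) (hk : k = j + 1) :
    Function.Exact (diffMap C i j) (diffMap C j k) := by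
  subst hi hk
  exact hC.exact j

/-- For a totally acyclic complex `C`, the modules `⋯ ⟶ (C_{-2})^* ⟶ (C_{-1})^*` form a resolution
of `M_C^*`. -/
lemma IsTotallyAcyclic.isFreeAugmentation_dual {C : CochainComplex (FGModuleCat.{u} A) ℤ}
    (hC : IsTotallyAcyclic C) :
    IsFreeAugmentation (dualComplex C) (-1) (dualAugmentation C) where
  free i := by
    have := hC.free (-i)
    exact inferInstanceAs (Module.Free A (Module.Dual A (C.X (-i))))
  exact i := hC.exact_dual_of_eq _ _ _ (by ring) (by ring)
  exact_aug := by
    have h : Function.Exact (diffMap C 1 2).dualMap (diffMap C 0 1).dualMap :=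
      hC.exact_dual_of_eq 0 1 2 (by norm_num) (by norm_num)
    change Function.Exact (diffMap C 1 2).dualMap (imageZero C).subtype.dualMap
    intro f
    refine Iff.trans ?_ (h f)
    constructor
    · intro hf
      ext x
      exact LinearMap.congr_fun hf ⟨diffMap C 0 1 x, x, rfl⟩
    · intro hf
      ext ⟨_, x, rfl⟩
      exact LinearMap.congr_fun hf x
  surjective := by
    change Function.Surjective (imageZero C).subtype.dualMap
    intro g
    have h : Function.Exact (diffMap C 0 1).dualMap (diffMap C (-1) 0).dualMap :=
      hC.exact_dual_of_eq (-1) 0 1 (by norm_num) (by norm_num)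
    obtain ⟨f, hf⟩ := (h (g.comp (diffMap C 0 1).rangeRestrict)).1 (by
      ext x
      have h0 : (diffMap C 0 1).rangeRestrict (diffMap C (-1) 0 x) = 0 :=
        Subtype.ext (diffMap_comp_apply C (-1) 0 1 x)
      exact (congrArg g h0).trans (map_zero g))
    refine ⟨f, ?_⟩
    ext ⟨_, x, rfl⟩
    exact LinearMap.congr_fun hf x

end Complexes

/-! ### The bounded derived category of finitely generated modules -/

section Derived

variable (A : Type u) [CommRing A] [IsNoetherianRing A]

/-- A construction of the derived category of finitely generated `A`-modules. -/
instance hasDerivedCategoryFG : HasDerivedCategory.{u + 1} (FGModuleCat.{u} A) :=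
  HasDerivedCategory.standard _

instance hasExtFG : HasExt.{u + 1} (FGModuleCat.{u} A) := hasExt_of_hasDerivedCategory _

/-- The bounded derived category `D^b(A)` of finitely generated `A`-modules. -/
abbrev Db : Type (u + 1) := DerivedCategory.Bounded (FGModuleCat.{u} A)

variable {A}

/-- A finitely generated module, as an object of `D^b(A)` concentrated in degree `0`. -/
def Db.single (N : FGModuleCat.{u} A) : Db A where
  obj := (DerivedCategory.singleFunctor _ 0).obj N
  property := ⟨⟨0, inferInstance⟩, ⟨0, inferInstance⟩⟩

variable (A) in
/-- The residue field `k`, as a finitely generated `A`-module. -/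
def residueFieldModule [IsLocalRing A] : FGModuleCat.{u} A :=
  FGModuleCat.of A (IsLocalRing.ResidueField A)

/-- The direct sum `M_C ⊕ M_C^*`. -/
def sumModuleOf (C : CochainComplex (FGModuleCat.{u} A) ℤ) : FGModuleCat.{u} A :=
  FGModuleCat.of A (imageZero C × Module.Dual A (imageZero C))

open CochainComplex.HomComplex Abelian in
/-- The class in `Extⁿ(N, N)` of a chain map `F : E ⟶ Σⁿ E`, where
`⋯ ⟶ E.X (q - 1) ⟶ E.X q ⟶ N ⟶ 0` is a resolution of `N` by free modules: the class of the cocycle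
`E.X (q - n) ⟶ E.X q ⟶ N`. -/
def extClassOf {E : CochainComplex (FGModuleCat.{u} A) ℤ} {q : ℤ} {N : FGModuleCat.{u} A}
    {ε : E.X q ⟶ N} (h : IsFreeAugmentation E q ε) {n : ℕ} (F : Cocycle E E (n : ℤ)) :
    Abelian.Ext N N n :=
  h.resolution.extMk (F.1.v (q - n) q (by omega) ≫ ε) (n + 1) rfl (by
    have hF := Cochain.congr_v (F.δ_eq_zero (n + 1)) (q - (n + 1 : ℕ)) q (by push_cast; ring)
    rw [δ_v (n : ℤ) (n + 1) rfl _ _ q _ (q - 1) (q - n) rfl (by push_cast; ring)] at hF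
    change E.d (q - (n + 1 : ℕ)) (q - n) ≫ F.1.v (q - n) q _ ≫ ε = 0
    have hF' := congrArg (fun g => g ≫ ε) hF
    simp only [Preadditive.add_comp, Category.assoc, h.d_comp, Limits.comp_zero, zero_add,
      Cochain.zero_v, Limits.zero_comp, Linear.units_smul_comp] at hF'
    rcases Int.even_or_odd ((n : ℤ) + 1) with hn | hn
    · rwa [Int.negOnePow_even _ hn, one_smul] at hF'
    · rwa [Int.negOnePow_odd _ hn, Units.neg_smul, one_smul, neg_eq_zero] at hF')

open CochainComplex.HomComplex in
/-- The anti-isomorphism `𝒟 : Ext(M, M) → Ext(M^*, M^*)` for `M = M_C` in degree `n`, given by its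
graph: `θ` is sent to `θ'` if, for some chain map `F : C ⟶ Σⁿ C` that corresponds to `θ`, the
transposed chain map `C^* ⟶ Σⁿ C^*` corresponds to `θ'`. -/
def DualizesTo {C : CochainComplex (FGModuleCat.{u} A) ℤ} (hC : IsTotallyAcyclic C) {n : ℕ}
    (θ : ShiftedHom (Db.single (moduleOf C)) (Db.single (moduleOf C)) (n : ℤ))
    (θ' : ShiftedHom (Db.single (dualModuleOf C)) (Db.single (dualModuleOf C)) (n : ℤ)) : Prop :=
  ∃ F : Cocycle C C (n : ℤ),
    (extClassOf hC.isFreeAugmentation F).hom = θ.map DerivedCategory.Bounded.ι ∧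
    (extClassOf hC.isFreeAugmentation_dual (dualCocycle F)).hom =
      θ'.map DerivedCategory.Bounded.ι

/-- The action of `H` on `D^b(A)` commutes with dualization of `M = M_C`:
`𝒟(φ_M(η)) = φ_{M^*}(η)` for all homogeneous `η` in `H`. -/
def CommutesWithDualization {H : Type v} [Ring H] {𝒜 : ℕ → AddSubgroup H} [GradedRing 𝒜]
    (act : CentralAction (Db A) 𝒜) {C : CochainComplex (FGModuleCat.{u} A) ℤ}
    (hC : IsTotallyAcyclic C) : Prop :=
  ∀ (n : ℕ) (η : 𝒜 n), DualizesTo hC (act.φ (Db.single (moduleOf C)) n η)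
    (act.φ (Db.single (dualModuleOf C)) n η)

end Derived

/-! ### Complexity -/

/-- The complexity of a sequence `b`: the infimum in `ℕ ∪ {∞}` of all `t ≥ 0` such that, for some
real `a`, `b n ≤ a n ^ (t - 1)` for all large `n`. -/
def complexity (b : ℕ → ℕ) : ℕ∞ :=
  sInf ((fun t : ℕ => (t : ℕ∞)) '' {t : ℕ | ∃ a : ℝ, ∀ᶠ n : ℕ in Filter.atTop,
    (b n : ℝ) ≤ a * (n : ℝ) ^ ((t : ℤ) - 1)})

section Betti

variable {A : Type u} [CommRing A] (C : CochainComplex (FGModuleCat.{u} A) ℤ)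

/-- The Betti numbers `β_n(M_C) = rank C_n`, for a minimal totally acyclic complex `C`. -/
def bettiNumber (n : ℤ) : ℕ := Module.finrank A (C.X (-n))

/-- The positive complexity `cx⁺ M_C`, for a minimal totally acyclic complex `C`. -/
def posComplexity : ℕ∞ := complexity fun n => bettiNumber C n

/-- The negative complexity `cx⁻ M_C`, for a minimal totally acyclic complex `C`. -/
def negComplexity : ℕ∞ := complexity fun n => bettiNumber C (-n)

end Betti

end

/-! Since $C$ is minimal, $\operatorname{rank}C_n$ is the length $\beta(n)$ of
$\operatorname{Hom}(C,\Sigma^nk)$ in the homotopy category, for every integer $n$. It suffices to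
prove $\operatorname{cx}^-\le\operatorname{cx}^+$ for $C$ and for $C^*$, since dualizing exchanges
the two ends of the complex. This inequality follows from a dichotomy for each $t$
(`IsCompleteResolution.negPolyBound_or_posPolyGrowth`): either $\beta(-n)=O(n^{t-1})$, read as
eventual vanishing when $t=0$, or $\beta(r+Nm)\ge cm^t$ for some $c>0$ along a progression. The
second case is incompatible with $\beta(n)\le an^{t-1}$ for $n\gg0$.

The dichotomy is proved by induction on $t$, for all complete resolutions $D$ of objects $X$ with
$\operatorname{Ext}(X,k)$ Noetherian in large degrees. Prime avoidance yields a homogeneous $\eta$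
of degree $e>0$ acting injectively on $\operatorname{Ext}^i(X,k)$ for $i\gg0$
(`exists_homogeneous_filterRegular`). The cone $X'$ of $\varphi_X(\eta)\colon X\to\Sigma^eX$ again
has $\operatorname{Ext}(X',k)$ Noetherian in large degrees, and $\varphi_X(\eta)$ lifts to
$D\to\Sigma^eD$, whose cone $D'$ is a complete resolution of $X'$ (`IsCompleteResolution.cone`). The
long exact sequence gives $\beta(i-e)\le\beta(i)+\beta'(i)$ for all $i$, and
$\beta(i)+\beta'(i+1+e)\le\beta(i+e)$ for $i\gg0$. Summing the first inequality carries an upper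
bound on the negative side from $D'$ to $D$ with the degree raised by one; summing the second does
the same for lower bounds on the positive side.

For $t=0$ the second inequality makes $\beta$ nondecreasing in steps of $e$ for large degrees. So
$\beta$ is positive along a progression or zero in all large degrees. In the latter case it is zero
everywhere (`dualExact.hom_residueField_eq_zero`): over a local ring, exactness of
$\operatorname{Hom}(D,k)$ in one degree, together with exactness of $\operatorname{Hom}(D,A)$,
propagates to the next.

Complete resolutions are treated up to homotopy so that they are stable under cones: $D$ consists of
finitely generated projectives, $\operatorname{Hom}(D,A)$ is exact, and $D$ maps to a projective
resolution $P$ of $X$ with a negligible cone. Negligible means receiving no maps from such $D$,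
which allows lifting, and having no maps to $\Sigma^ik$ for $i\gg0$, which allows comparison with
$\operatorname{Ext}(X,k)$. -/

noncomputable section

/-! ### Filter-regular homogeneous elements -/

section FilterRegular

variable {R : Type*} [CommRing R] (B : ℕ → AddSubgroup R) [SetLike.GradedMonoid B]

lemma exists_homogeneous_mem_forall_notMem (S : Finset (Ideal R)) (q : Ideal R) [hq : q.IsPrime]
    (h : ∀ p ∈ S, ∃ n, ∃ b ∈ B n, b ∈ p ∧ b ∉ q) :
    ∃ n, ∃ c ∈ B n, c ∉ q ∧ ∀ p ∈ S, c ∈ p := by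
  classical
  induction S using Finset.induction_on with
  | empty => exact ⟨0, 1, SetLike.GradedOne.one_mem, (Ideal.ne_top_iff_one q).1 hq.ne_top, by simp⟩
  | insert p S _ ih =>
    obtain ⟨n, c, hc, hcq, hcS⟩ := ih fun p hp => h p (Finset.mem_insert_of_mem hp)
    obtain ⟨m, b, hb, hbp, hbq⟩ := h p (Finset.mem_insert_self _ _)
    refine ⟨m + n, b * c, SetLike.GradedMul.mul_mem hb hc, fun hbc => ?_, fun p' hp' => ?_⟩
    · exact (hq.mem_or_mem hbc).elim hbq hcq
    · rcases Finset.mem_insert.1 hp' with rfl | hp'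
      · exact Ideal.mul_mem_right _ _ hbp
      · exact Ideal.mul_mem_left _ _ (hcS p' hp')

/-- Homogeneous prime avoidance: a homogeneous element of positive degree outside finitely many
prime ideals. -/
lemma exists_homogeneous_forall_notMem (S : Finset (Ideal R)) (hS : ∀ p ∈ S, p.IsPrime)
    (h : ∀ p ∈ S, ∃ n > 0, ∃ a ∈ B n, a ∉ p) : ∃ n > 0, ∃ a ∈ B n, ∀ p ∈ S, a ∉ p := by
  classical
  induction hn : S.card generalizing S with
  | zero =>
    rw [Finset.card_eq_zero] at hn
    subst hn
    exact ⟨1, one_pos, 0, zero_mem _, by simp⟩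
  | succ k ih =>
    have hne : S.Nonempty := Finset.card_pos.1 (by omega)
    -- Minimality concerns the sets of homogeneous elements. If all homogeneous elements of some
    -- other `p` lie in `q`, then `p` and `q` have the same homogeneous elements, so `η ∈ q` would
    -- force `η ∈ p`.
    obtain ⟨q, hqS, hqmin⟩ := S.finite_toSet.exists_minimalFor
      (fun p : Ideal R => {a : R | a ∈ p ∧ ∃ j, a ∈ B j}) _ hne
    have hqS : q ∈ S := hqS
    have hq := hS q hqS
    obtain ⟨n, hn0, η, hη, hηS⟩ := ih (S.erase q) (fun p hp => hS p (Finset.mem_of_mem_erase hp))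
      (fun p hp => h p (Finset.mem_of_mem_erase hp)) (by rw [Finset.card_erase_of_mem hqS]; omega)
    by_cases hηq : η ∈ q
    · obtain ⟨m, c, hc, hcq, hcS⟩ := exists_homogeneous_mem_forall_notMem B (S.erase q) q
        fun p hp => by
          by_contra! hcon
          refine hηS p hp ((hqmin (j := p) (Finset.mem_of_mem_erase hp) ?_) ⟨hηq, n, hη⟩).1
          rintro a ⟨hap, j, haj⟩
          exact ⟨hcon j a haj hap, j, haj⟩
      obtain ⟨l, hl, a, ha, haq⟩ := h q hqS
      have hca := SetLike.GradedMul.mul_mem hc ha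
      -- The powers equalize the degrees. The factor `a` supplies positive degree, since `c` may
      -- have degree zero. Exactly one of the two summands lies in each prime of `S`.
      refine ⟨n * (m + l), by positivity, η ^ (m + l) + (c * a) ^ n, add_mem ?_ ?_, ?_⟩
      · simpa [mul_comm] using SetLike.pow_mem_graded (m + l) hη
      · simpa using SetLike.pow_mem_graded n hca
      · intro p hp hmem
        by_cases hpq : p = q
        · subst hpq
          have h1 : η ^ (m + l) ∈ p := Ideal.pow_mem_of_mem _ hηq _ (by omega)
          have h2 := hq.mem_of_pow_mem _ ((Ideal.add_mem_iff_right _ h1).1 hmem)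
          exact (hq.mem_or_mem h2).elim hcq haq
        · have hpS := Finset.mem_erase.2 ⟨hpq, hp⟩
          have h1 : (c * a) ^ n ∈ p :=
            Ideal.pow_mem_of_mem _ (Ideal.mul_mem_right _ _ (hcS p hpS)) _ hn0
          exact hηS p hpS ((hS p hp).mem_of_pow_mem _ ((Ideal.add_mem_iff_left _ h1).1 hmem))
    · refine ⟨n, hn0, η, hη, fun p hp => ?_⟩
      by_cases hpq : p = q
      · rwa [hpq]
      · exact hηS p (Finset.mem_erase.2 ⟨hpq, hp⟩)

variable (hB : AddSubgroup.closure (⋃ n, (B n : Set R)) = ⊤)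
  {E : Type*} [AddCommGroup E] [Module R E]
  (π : ℤ → E →+ E) (d : ℕ)
  (hπ : ∀ (m : ℕ), ∀ a ∈ B m, ∀ (n : ℤ) (y : E), π (n + d * m) (a • y) = a • π n y)
  (hsep : ∀ y : E, (∀ n, π n y = 0) → y = 0)
  (hfin : ∀ y : E, ∃ b : ℤ, ∀ n, b ≤ |n| → π n y = 0)

/-- The elements annihilated by all homogeneous elements of sufficiently large degree. -/
def gradedTorsion (E : Type*) [AddCommGroup E] [Module R E] : Submodule R E where
  carrier := {y | ∃ m : ℕ, ∀ n ≥ m, ∀ a ∈ B n, a • y = 0}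
  zero_mem' := ⟨0, fun n _ a _ => smul_zero a⟩
  add_mem' := by
    rintro x y ⟨m, hm⟩ ⟨m', hm'⟩
    refine ⟨max m m', fun n hn a ha => ?_⟩
    rw [smul_add, hm n (le_of_max_le_left hn) a ha, hm' n (le_of_max_le_right hn) a ha, add_zero]
  smul_mem' := by
    rintro c x ⟨m, hm⟩
    refine ⟨m, fun n hn a ha => ?_⟩
    rw [smul_comm, hm n hn a ha, smul_zero]

lemma exists_forall_smul_eq_zero_of_le_gradedTorsion [IsNoetherian R E] :
    ∃ m : ℕ, ∀ n ≥ m, ∀ a ∈ B n, ∀ y ∈ gradedTorsion B E, a • y = 0 := by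
  classical
  obtain ⟨s, hs⟩ := IsNoetherian.noetherian (gradedTorsion B E)
  have h : ∀ y ∈ s, ∃ m : ℕ, ∀ n ≥ m, ∀ a ∈ B n, a • y = 0 := fun y hy => by
    have : y ∈ gradedTorsion B E := hs ▸ Submodule.subset_span hy
    exact this
  choose! f hf using h
  refine ⟨s.sup f, fun n hn a ha y hy => ?_⟩
  rw [← hs] at hy
  induction hy using Submodule.span_induction with
  | mem x hx => exact hf x hx n ((Finset.le_sup hx).trans hn) a ha
  | zero => exact smul_zero a
  | add x y _ _ hx hy => rw [smul_add, hx, hy, add_zero]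
  | smul c x _ hx => rw [smul_comm, hx, smul_zero]

include hB hπ hfin in
-- The torsion has finitely many generators, with components below some degree `b`, and a common `m`
-- such that elements of degree at least `m` kill them. Multiples of the generators therefore live
-- below degree `b + d * m`.
lemma exists_forall_component_eq_zero_of_mem_gradedTorsion [IsNoetherian R E] :
    ∃ b : ℤ, ∀ y ∈ gradedTorsion B E, ∀ n ≥ b, π n y = 0 := by
  classical
  obtain ⟨m, hm⟩ := exists_forall_smul_eq_zero_of_le_gradedTorsion B (E := E)
  obtain ⟨s, hs⟩ := IsNoetherian.noetherian (gradedTorsion B E)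
  choose f hf using hfin
  obtain ⟨b, hb⟩ : ∃ b : ℤ, ∀ y ∈ s, f y ≤ b := by
    obtain ⟨b, hb⟩ := (s.image f).bddAbove
    exact ⟨b, fun y hy => hb (Finset.mem_coe.2 (Finset.mem_image_of_mem f hy))⟩
  have key : ∀ x ∈ s, ∀ c : R, ∀ n ≥ b + d * m, π n (c • x) = 0 := by
    intro x hx c n hn
    have hc : c ∈ AddSubgroup.closure (⋃ n, (B n : Set R)) := hB ▸ AddSubgroup.mem_top c
    induction hc using AddSubgroup.closure_induction with
    | mem a ha =>
      obtain ⟨j, ha⟩ := Set.mem_iUnion.1 ha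
      have hxT : x ∈ gradedTorsion B E := hs ▸ Submodule.subset_span hx
      by_cases hj : m ≤ j
      · rw [hm j hj a ha x hxT, map_zero]
      · have := hπ j a ha (n - d * j) x
        rw [sub_add_cancel] at this
        have hdj : (d * j : ℤ) ≤ d * m := by
          exact_mod_cast Nat.mul_le_mul_left d (by omega)
        rw [this, hf x _ ((le_abs_self _).trans' (by linarith [hb x hx])), smul_zero]
    | zero => rw [zero_smul, map_zero]
    | add a b _ _ ha hb => rw [add_smul, map_add, ha, hb, add_zero]
    | neg a _ ha => rw [neg_smul, map_neg, ha, neg_zero]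
  refine ⟨b + d * m, fun y hy n hn => ?_⟩
  rw [← hs] at hy
  suffices h : ∀ c : R, π n (c • y) = 0 by simpa using h 1
  induction hy using Submodule.span_induction with
  | mem x hx => exact fun c => key x hx c n hn
  | zero => simp
  | add x y _ _ hx hy => intro c; rw [smul_add, map_add, hx, hy, add_zero]
  | smul a x _ hx => intro c; rw [smul_smul, hx]

include hB hπ hsep hfin in
/-- A Noetherian graded module over a Noetherian ring admits a homogeneous element of positive
degree whose kernel vanishes in large degrees. -/
lemma exists_homogeneous_filterRegular_of_isNoetherianRing [IsNoetherianRing R]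
    [Module.Finite R E] (hd : 0 < d) :
    ∃ m > 0, ∃ a ∈ B m, ∃ b : ℤ, ∀ y : E, a • y = 0 → ∀ n ≥ b, π n y = 0 := by
  classical
  set T := gradedTorsion B E with hT
  obtain ⟨b, hb⟩ := exists_forall_component_eq_zero_of_mem_gradedTorsion B hB π d hπ hfin
  -- A homogeneous element outside the finitely many associated primes of `E ⧸ T` is regular on `E ⧸
  -- T`, so its kernel on `E` lies in `T`. Avoidance applies once no associated prime contains
  -- everything homogeneous of positive degree.
  have hfinite := associatedPrimes.finite R (E ⧸ T)
  obtain ⟨e, he, a, ha, hav⟩ := exists_homogeneous_forall_notMem B hfinite.toFinset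
    (fun p hp => by
      have : IsAssociatedPrime p (E ⧸ T) := hfinite.mem_toFinset.1 hp
      exact this.1)
    (fun p hp => by
      have hp : IsAssociatedPrime p (E ⧸ T) := hfinite.mem_toFinset.1 hp
      obtain ⟨hprime, x, hx⟩ := isAssociatedPrime_iff.1 hp
      by_contra! hcon
      obtain ⟨y, rfl⟩ := T.mkQ_surjective x
      have hcon' : ∀ n > 0, ∀ a ∈ B n, a • y ∈ T := by
        intro n hn a ha
        have := hcon n hn a ha
        rw [hx, Submodule.mem_colon_singleton] at this
        rwa [Submodule.mem_bot, ← map_smul, Submodule.mkQ_apply,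
          Submodule.Quotient.mk_eq_zero] at this
      -- For `a` of large degree `j`, the components of `a • y` from degree `b` on vanish because `a
      -- • y ∈ T`. Those below `b` come from components of `y` in degrees below `-b'`, which are
      -- zero.
      have hyT : y ∈ T := by
        obtain ⟨b', hb'⟩ := hfin y
        refine ⟨(b + b').toNat + 1, fun j hj a ha => hsep _ fun n => ?_⟩
        have hjb : b + b' ≤ d * j := by
          have h1 : ((b + b').toNat + 1 : ℤ) ≤ j := by exact_mod_cast hj
          have h2 : (j : ℤ) ≤ d * j := by exact_mod_cast Nat.le_mul_of_pos_left j hd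
          linarith [Int.self_le_toNat (b + b')]
        by_cases hn : b ≤ n
        · exact hb _ (hcon' j (by omega) a ha) n hn
        · have := hπ j a ha (n - d * j) y
          rw [sub_add_cancel] at this
          rw [this, hb' _ ((neg_le_abs _).trans' (by linarith)), smul_zero]
      refine hprime.ne_top ?_
      rw [Ideal.eq_top_iff_one, hx, Submodule.mem_colon_singleton, one_smul, Submodule.mem_bot,
        Submodule.mkQ_apply, (Submodule.Quotient.mk_eq_zero T).2 hyT])
  refine ⟨e, he, a, ha, b, fun y hy => hb y ?_⟩
  by_contra hyT
  have : a ∈ ⋃ p ∈ associatedPrimes R (E ⧸ T), (p : Set R) := by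
    rw [biUnion_associatedPrimes_eq_zero_divisors]
    refine ⟨T.mkQ y, ?_, by rw [← map_smul, hy, map_zero]⟩
    rwa [Ne, Submodule.mkQ_apply, Submodule.Quotient.mk_eq_zero]
  obtain ⟨p, hp, hap⟩ := Set.mem_iUnion₂.1 this
  exact hav p (hfinite.mem_toFinset.2 hp) hap

/-- Evaluation at finitely many generators embeds the quotient ring in a finite power of `E`. -/
lemma isNoetherianRing_quotient_annihilator [IsNoetherian R E] :
    IsNoetherianRing (R ⧸ Module.annihilator R E) := by
  classical
  obtain ⟨s, hs⟩ := IsNoetherian.noetherian (⊤ : Submodule R E)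
  let f : R →ₗ[R] (s → E) := LinearMap.pi fun x => LinearMap.toSpanSingleton R E x
  have hf : LinearMap.ker f = Module.annihilator R E := by
    ext r
    rw [LinearMap.mem_ker, Module.mem_annihilator]
    refine ⟨fun h y => ?_, fun h => funext fun x => h x⟩
    have hy : y ∈ Submodule.span R (s : Set E) := hs ▸ Submodule.mem_top
    induction hy using Submodule.span_induction with
    | mem x hx => exact congrFun h ⟨x, hx⟩
    | zero => exact smul_zero r
    | add x y _ _ hx hy => rw [smul_add, hx, hy, add_zero]
    | smul c x _ hx => rw [smul_comm, hx, smul_zero]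
  have : IsNoetherian R (R ⧸ LinearMap.ker f) :=
    isNoetherian_of_injective _ (LinearMap.ker_eq_bot.1 (Submodule.ker_liftQ_eq_bot' _ f rfl))
  rw [hf] at this
  exact isNoetherian_of_tower R this

include hB hπ hsep hfin in
/-- A Noetherian graded module admits a homogeneous element of positive degree whose kernel
vanishes in large degrees. -/
lemma exists_homogeneous_filterRegular [IsNoetherian R E] (hd : 0 < d) :
    ∃ m > 0, ∃ a ∈ B m, ∃ b : ℤ, ∀ y : E, a • y = 0 → ∀ n ≥ b, π n y = 0 := by
  have := isNoetherianRing_quotient_annihilator (R := R) (E := E)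
  let q := Ideal.Quotient.mk (Module.annihilator R E)
  let : Module (R ⧸ Module.annihilator R E) E := Module.quotientAnnihilator
  have hq : ∀ (a : R) (y : E), q a • y = a • y := fun a y => rfl
  have : IsScalarTower R (R ⧸ Module.annihilator R E) E := ⟨fun a b y => by
    obtain ⟨b, rfl⟩ := Ideal.Quotient.mk_surjective b
    change q (a * b) • y = a • q b • y
    rw [hq, hq, mul_smul]⟩
  have : Module.Finite (R ⧸ Module.annihilator R E) E := Module.Finite.of_restrictScalars_finite R _ E
  let B' : ℕ → AddSubgroup (R ⧸ Module.annihilator R E) := fun n => (B n).map q.toAddMonoidHom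
  have : SetLike.GradedMonoid B' :=
    { one_mem := ⟨1, SetLike.GradedOne.one_mem, rfl⟩
      mul_mem := by
        rintro i j _ _ ⟨a, ha, rfl⟩ ⟨b, hb, rfl⟩
        exact ⟨a * b, SetLike.GradedMul.mul_mem ha hb, map_mul q a b⟩ }
  obtain ⟨m, hm, _, ⟨a, ha, rfl⟩, b, hb⟩ := exists_homogeneous_filterRegular_of_isNoetherianRing B'
    (E := E) (by
      rw [eq_top_iff]
      rintro x -
      obtain ⟨r, rfl⟩ := Ideal.Quotient.mk_surjective x
      have hr : r ∈ AddSubgroup.closure (⋃ n, (B n : Set R)) := hB ▸ AddSubgroup.mem_top r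
      induction hr using AddSubgroup.closure_induction with
      | mem a ha =>
        obtain ⟨j, ha⟩ := Set.mem_iUnion.1 ha
        exact AddSubgroup.subset_closure (Set.mem_iUnion.2 ⟨j, a, ha, rfl⟩)
      | zero => rw [map_zero]; exact zero_mem _
      | add a b _ _ ha hb => rw [map_add]; exact add_mem ha hb
      | neg a _ ha => rw [map_neg]; exact neg_mem ha) π d
    (by
      rintro m _ ⟨a, ha, rfl⟩ n y
      exact hπ m a ha n y) hsep hfin hd
  exact ⟨m, hm, a, ha, b, fun y hy => hb y hy⟩

end FilterRegular

end

noncomputable section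

/-! ### Growth of sequences indexed by the integers -/

section Growth

/-- Polynomial growth of degree at most `t - 1` in the negative direction. -/
def NegPolyBound (t : ℕ) (g : ℤ → ℕ) : Prop :=
  ∃ a j₀ : ℕ, ∀ j : ℕ, j₀ ≤ j → g (-(j : ℤ)) ≤ a * t * j ^ (t - 1)

/-- Polynomial growth of degree at least `t` in the positive direction, along some arithmetic
progression. -/
def PosPolyGrowth (t : ℕ) (f : ℤ → ℕ) : Prop :=
  ∃ c : ℝ, 0 < c ∧ ∃ N : ℕ, 0 < N ∧ ∃ r : ℤ, ∀ m : ℕ, c * (m : ℝ) ^ t ≤ f (r + N * m)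

lemma pow_add_mul_pow_pred_le (i t : ℕ) : i ^ t + t * i ^ (t - 1) ≤ (i + 1) ^ t := by
  induction t with
  | zero => simp
  | succ t ih =>
    rcases t with _ | t
    · simp
    · have h := Nat.mul_le_mul_right (i + 1) ih
      simp only [Nat.add_sub_cancel] at h ⊢
      rw [pow_succ (i + 1) (t + 1)]
      refine le_trans ?_ h
      have : (i ^ (t + 1) + (t + 1) * i ^ t) * (i + 1) =
          i ^ (t + 1 + 1) + (t + 1 + 1) * i ^ (t + 1) + (t + 1) * i ^ t := by ring
      rw [this]
      exact Nat.le_add_right _ _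

lemma pow_succ_le_add (m : ℕ) (t : ℕ) :
    ((m : ℝ) + 1) ^ (t + 1) ≤ (m : ℝ) ^ (t + 1) + (t + 1) * ((m : ℝ) + 1) ^ t := by
  induction t with
  | zero => simp
  | succ t ih =>
    have h := mul_le_mul_of_nonneg_left ih (by positivity : (0 : ℝ) ≤ (m : ℝ) + 1)
    have h2 : (m : ℝ) ^ (t + 1) ≤ ((m : ℝ) + 1) ^ (t + 1) := by gcongr; linarith
    have e1 : ((m : ℝ) + 1) ^ (t + 1 + 1) = (m + 1) * ((m : ℝ) + 1) ^ (t + 1) := by ring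
    have e2 : ((m : ℝ) + 1) * ((m : ℝ) ^ (t + 1) + (t + 1) * ((m : ℝ) + 1) ^ t) =
      (m : ℝ) ^ (t + 1 + 1) + (m : ℝ) ^ (t + 1) + (t + 1) * ((m : ℝ) + 1) ^ (t + 1) := by ring
    push_cast
    rw [e1]
    rw [e2] at h
    nlinarith

/-- Iterating the inequality sums the values of `g'`, and `pow_add_mul_pow_pred_le` compares the sum
with `a * j ^ t`. The constant `B` absorbs the initial values. The factor `t` in `NegPolyBound`
turns the case `t = 0` into eventual vanishing, from which boundedness of `g` results. -/
lemma NegPolyBound.step {t e : ℕ} (he : 0 < e) {g g' : ℤ → ℕ}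
    (h : ∀ i, g (i - e) ≤ g i + g' i) (hg' : NegPolyBound t g') : NegPolyBound (t + 1) g := by
  obtain ⟨a, j₀, ha⟩ := hg'
  set B := ∑ i ∈ Finset.range (j₀ + e), g (-(i : ℤ)) with hB
  have key : ∀ j : ℕ, g (-(j : ℤ)) ≤ a * j ^ t + B := by
    intro j
    induction j using Nat.strong_induction_on with
    | _ j ih =>
      by_cases hj : j < j₀ + e
      · exact le_add_left (Finset.single_le_sum (f := fun i : ℕ => g (-(i : ℤ)))
          (fun _ _ => Nat.zero_le _) (Finset.mem_range.2 hj))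
      · obtain ⟨i, rfl⟩ : ∃ i, j = i + e := ⟨j - e, by omega⟩
        have h1 := h (-(i : ℤ))
        rw [show -(i : ℤ) - e = -((i + e : ℕ) : ℤ) by push_cast; ring] at h1
        have h2 := ih i (by omega)
        have h3 := ha i (by omega)
        have h4 : i ^ t + t * i ^ (t - 1) ≤ (i + e) ^ t :=
          (pow_add_mul_pow_pred_le i t).trans (Nat.pow_le_pow_left (by omega) t)
        have h5 := Nat.mul_le_mul_left a h4
        rw [mul_add, ← mul_assoc] at h5
        omega
  refine ⟨a + B, 1, fun j hj => (key j).trans ?_⟩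
  have hj1 : 1 ≤ j ^ t := Nat.one_le_pow _ _ hj
  rw [Nat.add_sub_cancel]
  calc a * j ^ t + B ≤ a * j ^ t + B * j ^ t := by
        gcongr; exact Nat.le_mul_of_pos_right _ hj1
    _ = (a + B) * 1 * j ^ t := by ring
    _ ≤ (a + B) * (t + 1) * j ^ t := by gcongr; omega

lemma PosPolyGrowth.zero {e : ℕ} (he : 0 < e) {f : ℤ → ℕ} {i₀ : ℤ}
    (h : ∀ i ≥ i₀, f i ≤ f (i + e)) (hne : ∀ b : ℤ, ∃ n ≥ b, f n ≠ 0) : PosPolyGrowth 0 f := by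
  obtain ⟨r, hr, hfr⟩ := hne i₀
  refine ⟨1, one_pos, e, he, r, fun m => ?_⟩
  rw [pow_zero, mul_one, Nat.one_le_cast]
  induction m with
  | zero => simpa using Nat.one_le_iff_ne_zero.2 hfr
  | succ m ih =>
    refine ih.trans ((h _ (by nlinarith [Nat.zero_le (e * m)])).trans (le_of_eq ?_))
    push_cast
    ring_nf

/-- A progression for `f` is chosen so that each of its steps picks up one term of the progression
for `f'`; these terms are then summed. -/
lemma PosPolyGrowth.step {t e : ℕ} (he : 0 < e) {f f' : ℤ → ℕ} {i₀ : ℤ}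
    (h : ∀ i ≥ i₀, f i + f' (i + 1 + e) ≤ f (i + e)) (hf' : PosPolyGrowth t f') :
    PosPolyGrowth (t + 1) f := by
  obtain ⟨c, hc, N, hN, r', hr'⟩ := hf'
  -- The size of `m₀` puts the starting point `r` beyond `i₀`, and `1 ≤ m₀` gives `m + 1 ≤ m₀ + e *
  -- m`. The value of `r` solves `i + 1 + e = r' + N * (m₀ + e * m)` for `i = r + N * e * m`.
  obtain ⟨m₀, hm₀, hm₀'⟩ : ∃ m₀ : ℕ, 1 ≤ m₀ ∧ i₀ + 1 + e - r' ≤ m₀ :=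
    ⟨(i₀ + 1 + e - r').toNat + 1, by omega, by omega⟩
  have hNm₀ : (m₀ : ℤ) ≤ N * m₀ := by exact_mod_cast Nat.le_mul_of_pos_left m₀ hN
  set r := r' + N * m₀ - 1 - e with hr
  have hri : i₀ ≤ r := by omega
  have hmono : ∀ i ≥ i₀, ∀ k : ℕ, f i ≤ f (i + e * k) := by
    intro i hi k
    induction k with
    | zero => simp
    | succ k ih =>
      refine ih.trans ((le_add_right le_rfl).trans ((h (i + e * k) ?_).trans (le_of_eq ?_)))
      · have : (0 : ℤ) ≤ e * k := by positivity
        omega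
      · push_cast; ring_nf
  -- The increment of `m ^ (t + 1)` is at most `(t + 1) * (m + 1) ^ t`, which explains the constant.
  -- Of the `N` steps of length `e`, the first contributes a value of `f'`; the others only use
  -- monotonicity.
  refine ⟨c / (t + 1), by positivity, N * e, by positivity, r, fun m => ?_⟩
  have ht : (0 : ℝ) < t + 1 := by positivity
  induction m with
  | zero => simp
  | succ m ih =>
    set i := r + ((N * e : ℕ) : ℤ) * m with hi
    have hi₀ : i₀ ≤ i := by
      have : (0 : ℤ) ≤ ((N * e : ℕ) : ℤ) * m := by positivity
      omega
    have h1 := h i hi₀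
    have h2 := hmono (i + e) (by omega) (N - 1)
    have e1 : i + e + e * ((N - 1 : ℕ) : ℤ) = r + ((N * e : ℕ) : ℤ) * ((m + 1 : ℕ) : ℤ) := by
      rw [hi]; push_cast [Nat.cast_sub (show 1 ≤ N from hN)]; ring
    have e2 : i + 1 + e = r' + N * ((m₀ + e * m : ℕ) : ℤ) := by
      rw [hi, hr]; push_cast; ring
    rw [e1] at h2
    have h3 := hr' (m₀ + e * m)
    rw [← e2] at h3
    have h4 : ((m : ℝ) + 1) ^ t ≤ ((m₀ + e * m : ℕ) : ℝ) ^ t := by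
      have : m + 1 ≤ m₀ + e * m := by
        have := Nat.le_mul_of_pos_left m he
        omega
      gcongr
      exact_mod_cast this
    have h5 : (f i : ℝ) + f' (i + 1 + e) ≤ f (r + ((N * e : ℕ) : ℤ) * ((m + 1 : ℕ) : ℤ)) := by
      exact_mod_cast h1.trans h2
    have h6 := mul_le_mul_of_nonneg_left (pow_succ_le_add m t)
      (by positivity : (0 : ℝ) ≤ c / (t + 1))
    have e3 : c / (t + 1) * ((m : ℝ) ^ (t + 1) + (t + 1) * ((m : ℝ) + 1) ^ t) =
        c / (t + 1) * (m : ℝ) ^ (t + 1) + c * ((m : ℝ) + 1) ^ t := by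
      field_simp
    have h7 := mul_le_mul_of_nonneg_left h4 hc.le
    push_cast at h6 h5 ⊢
    push_cast at h7 h3
    linarith

lemma not_bound_of_posPolyGrowth {t : ℕ} {f : ℤ → ℕ} {a : ℝ}
    (h : ∀ᶠ n : ℕ in Filter.atTop, (f n : ℝ) ≤ a * (n : ℝ) ^ ((t : ℤ) - 1)) :
    ¬ PosPolyGrowth t f := by
  rintro ⟨c, hc, N, hN, r, hf⟩
  obtain ⟨n₀, hn₀⟩ := Filter.eventually_atTop.1 h
  -- Multiplying `c * m ^ t ≤ a * n ^ (t - 1)` by `n = r + N * m` and bounding `n` by `(|r| + N) *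
  -- m` leaves `c * n ≤ |a| * (|r| + N) ^ t`, which fails once `n ≥ K`.
  obtain ⟨K, hK⟩ := exists_nat_gt (|a| * ((r.natAbs : ℝ) + N) ^ t / c)
  set m := K + n₀ + 2 * r.natAbs + 1 with hm
  have hNm : m ≤ N * m := Nat.le_mul_of_pos_left m hN
  obtain ⟨n, hn⟩ : ∃ n : ℕ, (n : ℤ) = r + N * m :=
    ⟨(r + N * m).toNat, Int.toNat_of_nonneg (by
      have : (m : ℤ) ≤ N * m := by exact_mod_cast hNm
      omega)⟩
  have hnm : (m : ℤ) ≤ N * m := by exact_mod_cast hNm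
  have hnK : K ≤ n := by omega
  have hn0 : 0 < n := by omega
  have h1 := hn₀ n (by omega)
  have h2 := hf m
  rw [← hn] at h2
  have hnpos : (0 : ℝ) < n := by exact_mod_cast hn0
  have hmpos : (0 : ℝ) < m := by positivity
  rw [zpow_sub_one₀ hnpos.ne', zpow_natCast] at h1
  have h3 : (n : ℝ) ≤ (r.natAbs + N) * m := by
    have : (n : ℤ) ≤ (r.natAbs + N) * m := by
      rw [hn, add_mul]
      have h4 : (r.natAbs : ℤ) ≤ r.natAbs * m := by
        exact_mod_cast Nat.le_mul_of_pos_right _ (by omega)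
      omega
    exact_mod_cast this
  have h4 : c * (m : ℝ) ^ t * n ≤ |a| * (((r.natAbs : ℝ) + N) ^ t * (m : ℝ) ^ t) := by
    rw [← mul_pow]
    calc c * (m : ℝ) ^ t * n ≤ a * ((n : ℝ) ^ t * (n : ℝ)⁻¹) * n :=
          mul_le_mul_of_nonneg_right (h2.trans h1) hnpos.le
      _ = a * (n : ℝ) ^ t := by field_simp
      _ ≤ |a| * (n : ℝ) ^ t := by gcongr; exact le_abs_self a
      _ ≤ _ := by gcongr
  have h5 : c * n ≤ |a| * ((r.natAbs : ℝ) + N) ^ t := by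
    have : 0 < (m : ℝ) ^ t := by positivity
    refine le_of_mul_le_mul_right ?_ this
    linarith
  have h6 : (K : ℝ) ≤ n := by exact_mod_cast hnK
  rw [div_lt_iff₀ hc] at hK
  nlinarith

/-- Every exponent admissible in the positive direction excludes the growth alternative, hence is
admissible in the negative direction. -/
lemma complexity_le_of_dichotomy {f b : ℤ → ℕ} (s : ℤ) (hfb : ∀ i, f i = b (i + s))
    (h : ∀ t, NegPolyBound t f ∨ PosPolyGrowth t f) :
    complexity (fun n => b (-n)) ≤ complexity (fun n => b n) := by
  refine sInf_le_sInf (Set.image_mono ?_)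
  rintro t ⟨a, ha⟩
  rcases h t with ⟨a', j₀, hb⟩ | ⟨c, hc, N, hN, r, hg⟩
  -- The reindexed argument `j + s` is at most `2 * j` for large `j`, which costs the factor `2 ^ (t
  -- - 1)`.
  · refine ⟨(a' * t * 2 ^ (t - 1) : ℕ), ?_⟩
    filter_upwards [Filter.eventually_ge_atTop (j₀ + s.natAbs)] with j hj
    obtain ⟨i, hi⟩ : ∃ i : ℕ, (i : ℤ) = j + s := ⟨(j + s).toNat, Int.toNat_of_nonneg (by omega)⟩
    have h1 := hb i (by omega)
    rw [hfb, hi, show -((j : ℤ) + s) + s = -(j : ℤ) by ring] at h1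
    rcases t with _ | t
    · have : b (-(j : ℤ)) = 0 := by simpa using h1
      simp [this]
    · have h2 : b (-(j : ℤ)) ≤ a' * (t + 1) * 2 ^ t * j ^ t := by
        refine h1.trans ?_
        rw [Nat.add_sub_cancel, mul_assoc _ (2 ^ t), ← mul_pow]
        gcongr
        omega
      have e : ((t + 1 : ℕ) : ℤ) - 1 = (t : ℤ) := by push_cast; ring
      rw [e, zpow_natCast, Nat.add_sub_cancel]
      exact_mod_cast h2
  · exact absurd ⟨c, hc, N, hN, r + s, fun m => by
      have := hg m
      rw [hfb] at this
      rwa [show r + s + N * (m : ℤ) = r + N * m + s by ring]⟩ (not_bound_of_posPolyGrowth ha)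

end Growth

end

noncomputable section

namespace CentralAction

variable {T : Type w} [Category.{w'} T] [Preadditive T] [HasShift T ℤ]
  [∀ n : ℤ, (shiftFunctor T n).Additive]
  {H : Type v} [Ring H] {𝒜 : ℕ → AddSubgroup H} [GradedRing 𝒜]
  (act : CentralAction T 𝒜)

/-! ### The modules `Ext(X, Y)` and the maps between them -/

@[elab_as_elim]
lemma ext_induction {X Y : T} {motive : act.Ext X Y → Prop} (x : act.Ext X Y)
    (zero : motive 0) (of : ∀ i (y : ShiftedHom X Y i), motive (act.ofDegree X Y i y))
    (add : ∀ x y, motive x → motive y → motive (x + y)) : motive x :=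
  DirectSum.induction_on (β := fun n : ℤ => ShiftedHom X Y n) x zero of add

lemma component_ofDegree_self (X Y : T) (n : ℤ) (x : ShiftedHom X Y n) :
    act.component X Y n (act.ofDegree X Y n x) = x :=
  DirectSum.of_eq_same (β := fun n : ℤ => ShiftedHom X Y n) n x

lemma eq_zero_of_component (X Y : T) (x : act.Ext X Y) (h : ∀ n, act.component X Y n x = 0) :
    x = 0 :=
  DFinsupp.ext (β := fun n : ℤ => ShiftedHom X Y n) h

lemma eq_sum_component (X Y : T) (x : act.Ext X Y) :
    ∃ s : Finset ℤ, x = ∑ i ∈ s, act.ofDegree X Y i (act.component X Y i x) ∧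
      ∀ n ∉ s, act.component X Y n x = 0 := by
  classical
  exact ⟨DFinsupp.support (β := fun n : ℤ => ShiftedHom X Y n) x,
    (DirectSum.sum_support_of (β := fun n : ℤ => ShiftedHom X Y n) x).symm,
    fun n hn => DFinsupp.notMem_support_iff.1 hn⟩

lemma component_smul (X Y : T) (m : ℕ) (a : 𝒜 m) (j c : ℤ) (h : (m : ℤ) + j = c)
    (x : act.Ext X Y) :
    act.component X Y c ((a : H) • x) = (act.component X Y j x).comp (act.φ Y m a) h := by
  induction x using act.ext_induction with
  | zero => rw [smul_zero, map_zero, map_zero, ShiftedHom.zero_comp]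
  | of i y =>
    rw [act.smul_ofDegree X Y m i _ rfl]
    by_cases hi : i = j
    · subst hi
      subst h
      rw [component_ofDegree_self, component_ofDegree_self]
    · rw [act.component_ofDegree_of_ne _ _ _ _ (by omega),
        act.component_ofDegree_of_ne _ _ _ _ hi, ShiftedHom.zero_comp]
  | add x y hx hy => rw [smul_add, map_add, map_add, hx, hy, ShiftedHom.add_comp]

/-- Precomposition with a morphism `X ⟶ Σʲ Y`, as an additive map `Ext(Y, Z) → Ext(X, Z)`. -/
def precompAddHom {X Y : T} {j : ℤ} (f : ShiftedHom X Y j) (Z : T) : act.Ext Y Z →+ act.Ext X Z :=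
  DirectSum.toAddMonoid (β := fun n : ℤ => ShiftedHom Y Z n) fun i =>
    (act.ofDegree X Z (i + j)).comp (AddMonoidHom.mk' (fun x => f.comp x rfl) fun x y => by simp)

lemma precompAddHom_ofDegree {X Y : T} {j : ℤ} (f : ShiftedHom X Y j) (Z : T) (i c : ℤ)
    (h : i + j = c) (x : ShiftedHom Y Z i) :
    act.precompAddHom f Z (act.ofDegree Y Z i x) = act.ofDegree X Z c (f.comp x h) := by
  subst h
  exact DirectSum.toAddMonoid_of _ _ _

lemma precompAddHom_smul {X Y : T} {j : ℤ} (f : ShiftedHom X Y j) (Z : T) (a : H)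
    (x : act.Ext Y Z) : act.precompAddHom f Z (a • x) = a • act.precompAddHom f Z x := by
  induction x using act.ext_induction with
  | zero => rw [smul_zero, map_zero, smul_zero]
  | add x y hx hy => rw [smul_add, map_add, map_add, smul_add, hx, hy]
  | of i x =>
    induction a using DirectSum.Decomposition.inductionOn 𝒜 with
    | zero => rw [zero_smul, zero_smul, map_zero]
    | add a b ha hb => rw [add_smul, add_smul, map_add, ha, hb]
    | homogeneous a =>
      rename_i m
      rw [act.smul_ofDegree Y Z m i _ rfl, act.precompAddHom_ofDegree f Z _ _ rfl,
        act.precompAddHom_ofDegree f Z _ _ rfl,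
        act.smul_ofDegree X Z m _ (m + i + j) (by ring)]
      congr 1
      exact (ShiftedHom.comp_assoc f x _ rfl rfl rfl).symm

/-- Precomposition with a morphism `X ⟶ Σʲ Y`, as an `H`-linear map `Ext(Y, Z) → Ext(X, Z)`. -/
def precomp {X Y : T} {j : ℤ} (f : ShiftedHom X Y j) (Z : T) : act.Ext Y Z →ₗ[H] act.Ext X Z where
  toFun := act.precompAddHom f Z
  map_add' := map_add _
  map_smul' := act.precompAddHom_smul f Z

lemma precomp_ofDegree {X Y : T} {j : ℤ} (f : ShiftedHom X Y j) (Z : T) (i c : ℤ)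
    (h : i + j = c) (x : ShiftedHom Y Z i) :
    act.precomp f Z (act.ofDegree Y Z i x) = act.ofDegree X Z c (f.comp x h) :=
  act.precompAddHom_ofDegree f Z i c h x

lemma component_precomp {X Y : T} {j : ℤ} (f : ShiftedHom X Y j) (Z : T) (i c : ℤ)
    (h : i + j = c) (x : act.Ext Y Z) :
    act.component X Z c (act.precomp f Z x) = f.comp (act.component Y Z i x) h := by
  induction x using act.ext_induction with
  | zero => rw [map_zero, map_zero, map_zero, ShiftedHom.comp_zero]
  | add x y hx hy => rw [map_add, map_add, map_add, hx, hy, ShiftedHom.comp_add]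
  | of l x =>
    rw [act.precomp_ofDegree f Z l _ rfl]
    by_cases hl : l = i
    · subst hl
      subst h
      rw [component_ofDegree_self, component_ofDegree_self]
    · rw [act.component_ofDegree_of_ne _ _ _ _ (by omega),
        act.component_ofDegree_of_ne _ _ _ _ hl, ShiftedHom.comp_zero]

lemma precomp_mem_extGE {X Y : T} {j : ℤ} (f : ShiftedHom X Y j) (Z : T) {n n' : ℤ}
    (hn : n' ≤ n + j) {x : act.Ext Y Z} (hx : x ∈ act.extGE Y Z n) :
    act.precomp f Z x ∈ act.extGE X Z n' := by
  intro c hc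
  rw [act.component_precomp f Z (c - j) c (by ring), hx (c - j) (by omega), ShiftedHom.comp_zero]

lemma extGE_antitone (X Y : T) {m n : ℤ} (h : m ≤ n) : act.extGE X Y n ≤ act.extGE X Y m :=
  fun _ hx i hi => hx i (by omega)

lemma ofDegree_mem_extGE (X Y : T) {m i : ℤ} (h : m ≤ i) (x : ShiftedHom X Y i) :
    act.ofDegree X Y i x ∈ act.extGE X Y m :=
  fun _ hn => act.component_ofDegree_of_ne _ _ _ _ (by omega) _

/-- `Ext(X, Y)` is Noetherian in large degrees. -/
def EventuallyNoetherian (X Y : T) : Prop :=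
  ∃ n₀ : ℤ, IsNoetherian H (act.extGE X Y n₀)

lemma isNoetherian_extGE_of_le {X Y : T} {m n : ℤ} (h : m ≤ n)
    (hm : IsNoetherian H (act.extGE X Y m)) : IsNoetherian H (act.extGE X Y n) :=
  isNoetherian_of_injective (Submodule.inclusion (act.extGE_antitone X Y h))
    (Submodule.inclusion_injective _)

/-- Precomposition with the split epimorphism `p` is `H`-linear and injective. -/
lemma EventuallyNoetherian.of_splitEpi {X Y Z : T} (p : X ⟶ Y) (s : Y ⟶ X) (hsp : s ≫ p = 𝟙 Y)
    (h : act.EventuallyNoetherian X Z) : act.EventuallyNoetherian Y Z := by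
  obtain ⟨n₀, h⟩ := h
  let f : ShiftedHom X Y (0 : ℤ) := ShiftedHom.mk₀ 0 rfl p
  refine ⟨n₀, isNoetherian_of_injective (((act.precomp f Z).domRestrict (act.extGE Y Z n₀)).codRestrict
    (act.extGE X Z n₀) fun x => act.precomp_mem_extGE f Z (by omega) x.2) ?_⟩
  rw [← LinearMap.ker_eq_bot, LinearMap.ker_eq_bot']
  rintro ⟨x, hx⟩ hx'
  have hx'' : act.precomp f Z x = 0 := congrArg Subtype.val hx'
  refine Subtype.ext (act.eq_zero_of_component Y Z x fun n => ?_)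
  have h1 := act.component_precomp f Z n n (add_zero n) x
  rw [hx'', map_zero, ShiftedHom.mk₀_comp] at h1
  have h2 := congrArg (fun g => s ≫ g) h1
  simpa [reassoc_of% hsp] using h2.symm

end CentralAction

end

noncomputable section

namespace CentralAction

open Pretriangulated

/-! ### Noetherian Ext modules and cones -/

section Cone

variable {T : Type w} [Category.{w'} T] [Preadditive T] [HasShift T ℤ]
  [∀ n : ℤ, (shiftFunctor T n).Additive] [Limits.HasZeroObject T] [Pretriangulated T]
  {H : Type v} [Ring H] {𝒜 : ℕ → AddSubgroup H} [GradedRing 𝒜]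
  (act : CentralAction T 𝒜)

/-- The long exact sequence places `Ext(X', Z)` between two shifted copies of `Ext(X, Z)`. Both maps
are precompositions, hence commute with the action of `H` on the target side. The morphism `g` is
regarded as a morphism `X ⟶ X'` of degree `-e`. -/
lemma EventuallyNoetherian.cone {X X' Z : T} {e : ℤ} {f : X ⟶ X⟦e⟧} {g : X⟦e⟧ ⟶ X'}
    {h : X' ⟶ X⟦(1 : ℤ)⟧} (hT : Triangle.mk f g h ∈ distTriang T)
    (hX : act.EventuallyNoetherian X Z) : act.EventuallyNoetherian X' Z := by
  obtain ⟨n₀, hX⟩ := hX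
  let u : X ≅ X⟦e⟧⟦-e⟧ := (shiftEquiv T e).unitIso.app X
  let g' : ShiftedHom X X' (-e) := u.hom ≫ g⟦-e⟧'
  have hg' : ∀ (i c : ℤ) (hic : i + -e = c) (x : ShiftedHom X' Z i), g'.comp x hic = 0 →
      ∃ y : ShiftedHom X Z (i - 1), ShiftedHom.comp (X := X') (Y := X) h y (by omega) = x := by
    intro i c hic x hx
    have h1 : g ≫ x = 0 := by
      apply (shiftFunctor T (-e)).map_injective
      rw [ShiftedHom.comp, ← Category.assoc, Preadditive.IsIso.comp_right_eq_zero] at hx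
      have hx' : u.hom ≫ g⟦-e⟧' ≫ x⟦-e⟧' = 0 :=
        (Category.assoc _ _ _).symm.trans hx
      rw [Preadditive.IsIso.comp_left_eq_zero] at hx'
      rw [Functor.map_comp, hx', Functor.map_zero]
    obtain ⟨y, hy⟩ : ∃ y : X⟦(1 : ℤ)⟧ ⟶ Z⟦i⟧, x = h ≫ y := Triangle.yoneda_exact₃ _ hT x h1
    refine ⟨(shiftFunctor T (1 : ℤ)).preimage
      (y ≫ (shiftFunctorAdd' T (i - 1) 1 i (by omega)).hom.app Z), ?_⟩
    rw [ShiftedHom.comp, Functor.map_preimage, Category.assoc, Iso.hom_inv_id_app,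
      Category.comp_id, hy]
  -- This makes both `m - e` and `m - 1` at least `n₀`.
  set m := n₀ + |e| + 1 with hm
  have h₁ : IsNoetherian H (act.extGE X Z (m - e)) :=
    act.isNoetherian_extGE_of_le (by have := le_abs_self e; omega) hX
  have h₂ : IsNoetherian H (act.extGE X Z (m - 1)) :=
    act.isNoetherian_extGE_of_le (by have := abs_nonneg e; omega) hX
  let α : act.extGE X Z (m - 1) →ₗ[H] act.extGE X' Z m :=
    ((act.precomp (X := X') (Y := X) (j := 1) h Z).domRestrict _).codRestrict _
      fun x => act.precomp_mem_extGE (X := X') (Y := X) (j := 1) h Z (by omega) x.2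
  let β : act.extGE X' Z m →ₗ[H] act.extGE X Z (m - e) :=
    ((act.precomp g' Z).domRestrict _).codRestrict _
      fun x => act.precomp_mem_extGE g' Z (by omega) x.2
  have hker : LinearMap.ker β ≤ LinearMap.range α := by
    rintro ⟨x, hx⟩ hxβ
    have hxβ : act.precomp g' Z x = 0 := congrArg Subtype.val (LinearMap.mem_ker.1 hxβ)
    obtain ⟨s, hs, -⟩ := act.eq_sum_component X' Z x
    have hy : ∀ i, ∃ y : ShiftedHom X Z (i - 1),
        ShiftedHom.comp (X := X') (Y := X) h y (by omega) = act.component X' Z i x := fun i =>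
      hg' i (i + -e) rfl _ (by
        rw [← act.component_precomp g' Z i _ rfl, hxβ, map_zero])
    choose y hy using hy
    have hz : ∑ i ∈ s.filter (m ≤ ·), act.ofDegree X Z (i - 1) (y i) ∈ act.extGE X Z (m - 1) :=
      Submodule.sum_mem _ fun i hi => act.ofDegree_mem_extGE X Z
        (by have := (Finset.mem_filter.1 hi).2; omega) _
    refine ⟨⟨_, hz⟩, Subtype.ext ?_⟩
    change act.precomp (X := X') (Y := X) (j := 1) h Z
      (∑ i ∈ s.filter (m ≤ ·), act.ofDegree X Z (i - 1) (y i)) = x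
    rw [map_sum]
    conv_rhs => rw [hs]
    rw [Finset.sum_filter]
    refine Finset.sum_congr rfl fun i _ => ?_
    split_ifs with hi
    · rw [act.precomp_ofDegree (X := X') (Y := X) (j := 1) h Z (i - 1) i (by omega), hy]
    · rw [hx i (by omega), map_zero]
  have : IsNoetherian H (LinearMap.ker β) :=
    isNoetherian_of_injective (Submodule.inclusion hker) (Submodule.inclusion_injective _)
  exact ⟨m, isNoetherian_of_range_eq_ker (LinearMap.ker β).subtype β
    (by rw [Submodule.range_subtype])⟩

end Cone

/-! ### Naturality and shifts of central elements -/

section Center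

variable {T : Type w} [Category.{w'} T] [Preadditive T] [HasShift T ℤ]
  [∀ n : ℤ, (shiftFunctor T n).Additive]
  {H : Type v} [Ring H] {𝒜 : ℕ → AddSubgroup H} [GradedRing 𝒜]
  (act : CentralAction T 𝒜)

lemma φ_naturality {X Y : T} (f : X ⟶ Y) (n : ℕ) (a : 𝒜 n) :
    f ≫ act.φ Y n a = act.φ X n a ≫ f⟦(n : ℤ)⟧' :=
  (act.toCenter n a).2.1 X Y f

lemma φ_shift_one (X : T) (n : ℕ) (a : 𝒜 n) :
    act.φ (X⟦(1 : ℤ)⟧) n a = (n : ℤ).negOnePow •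
      ((act.φ X n a)⟦(1 : ℤ)⟧' ≫ (shiftComm X (n : ℤ) 1).hom) :=
  (act.toCenter n a).2.2 X

/-- The graded center prescribes the behaviour under a single shift, hence the induction on a
natural number `j`. Signs and commutation isomorphisms do not affect the vanishing of composites, so
the form of `β` is irrelevant. -/
lemma exists_iso_φ_shift (X : T) (n : ℕ) (a : 𝒜 n) (j : ℕ) :
    ∃ β : X⟦(n : ℤ)⟧⟦(j : ℤ)⟧ ≅ X⟦(j : ℤ)⟧⟦(n : ℤ)⟧,
      act.φ (X⟦(j : ℤ)⟧) n a = (act.φ X n a)⟦(j : ℤ)⟧' ≫ β.hom := by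
  induction j with
  | zero =>
    let α : shiftFunctor T ((0 : ℕ) : ℤ) ≅ 𝟭 T := shiftFunctorZero' T _ Nat.cast_zero
    refine ⟨α.app _ ≪≫ (shiftFunctor T (n : ℤ)).mapIso (α.symm.app X), ?_⟩
    have h1 := act.φ_naturality (α.hom.app X) n a
    have h2 := α.hom.naturality (act.φ X n a)
    simp only [Functor.id_map] at h2
    rw [← cancel_mono ((α.hom.app X)⟦(n : ℤ)⟧'), ← h1]
    simp only [Functor.id_obj, Iso.trans_hom, Functor.mapIso_hom, Iso.app_hom, Iso.symm_hom,
      Category.assoc, ← Functor.map_comp, Iso.inv_hom_id_app, CategoryTheory.Functor.map_id,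
      Category.comp_id]
    exact h2.symm
  | succ j ih =>
    obtain ⟨β, hβ⟩ := ih
    let α : shiftFunctor T ((j + 1 : ℕ) : ℤ) ≅ shiftFunctor T (j : ℤ) ⋙ shiftFunctor T (1 : ℤ) :=
      shiftFunctorAdd' T (j : ℤ) 1 _ (by push_cast; rfl)
    let u : (X⟦(j : ℤ)⟧⟦(n : ℤ)⟧)⟦(1 : ℤ)⟧ ≅ X⟦(j : ℤ)⟧⟦(1 : ℤ)⟧⟦(n : ℤ)⟧ :=
      { hom := (n : ℤ).negOnePow • (shiftComm (X⟦(j : ℤ)⟧) (n : ℤ) 1).hom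
        inv := (n : ℤ).negOnePow • (shiftComm (X⟦(j : ℤ)⟧) (n : ℤ) 1).inv
        hom_inv_id := by
          rw [Linear.units_smul_comp, Linear.comp_units_smul, smul_smul, Int.units_mul_self,
            one_smul, Iso.hom_inv_id]
        inv_hom_id := by
          rw [Linear.units_smul_comp, Linear.comp_units_smul, smul_smul, Int.units_mul_self,
            one_smul, Iso.inv_hom_id] }
    refine ⟨α.app _ ≪≫ (shiftFunctor T (1 : ℤ)).mapIso β ≪≫ u ≪≫
      (shiftFunctor T (n : ℤ)).mapIso (α.symm.app X), ?_⟩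
    have h1 := act.φ_naturality (α.hom.app X) n a
    have h2 := α.hom.naturality (act.φ X n a)
    have h3 := act.φ_shift_one (X⟦(j : ℤ)⟧) n a
    rw [← cancel_mono ((α.hom.app X)⟦(n : ℤ)⟧'), ← h1]
    simp only [Functor.comp_obj, Functor.comp_map, Iso.trans_hom, Functor.mapIso_hom, Iso.app_hom,
      Iso.symm_hom, Category.assoc, ← Functor.map_comp, Iso.inv_hom_id_app] at h2 ⊢
    rw [reassoc_of% h2]
    simp only [CategoryTheory.Functor.map_id, Category.comp_id]
    rw [h3, hβ]
    simp [u]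

end Center
end CentralAction

end

noncomputable section

/-! ### Reduction to the commutative even subring -/

section EvenSubring

variable {H : Type v} [Ring H] (𝒜 : ℕ → AddSubgroup H) [GradedRing 𝒜]

/-- The subring generated by the homogeneous elements of even degree. -/
def evenSubring : Subring H := Subring.closure {x | ∃ n, x ∈ 𝒜 (2 * n)}

lemma mem_evenSubring {n : ℕ} {x : H} (hx : x ∈ 𝒜 (2 * n)) : x ∈ evenSubring 𝒜 :=
  Subring.subset_closure ⟨n, hx⟩

/-- The elements of degree `2 * n` in the even subring. -/
def evenDegree (n : ℕ) : AddSubgroup (evenSubring 𝒜) :=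
  (𝒜 (2 * n)).comap (evenSubring 𝒜).subtype.toAddMonoidHom

lemma mem_evenDegree {n : ℕ} {x : evenSubring 𝒜} : x ∈ evenDegree 𝒜 n ↔ (x : H) ∈ 𝒜 (2 * n) :=
  Iff.rfl

instance : SetLike.GradedMonoid (evenDegree 𝒜) where
  one_mem := SetLike.GradedOne.one_mem (A := 𝒜)
  mul_mem i j a b ha hb := by
    rw [mem_evenDegree] at ha hb ⊢
    rw [mul_add]
    exact SetLike.GradedMul.mul_mem ha hb

/-- Homogeneous elements of even degree are closed under products, so the ring they generate is
already their additive span. -/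
lemma closure_iUnion_evenDegree :
    AddSubgroup.closure (⋃ n, (evenDegree 𝒜 n : Set (evenSubring 𝒜))) = ⊤ := by
  rw [eq_top_iff]
  rintro ⟨x, hx⟩ -
  have hx' := Subring.mem_closure_iff.1 hx
  have hS : ∀ y ∈ Submonoid.closure {x | ∃ n, x ∈ 𝒜 (2 * n)}, ∃ n, y ∈ 𝒜 (2 * n) := by
    intro y hy
    induction hy using Submonoid.closure_induction with
    | mem y hy => exact hy
    | one => exact ⟨0, (SetLike.GradedOne.one_mem : (1 : H) ∈ 𝒜 0)⟩
    | mul a b _ _ ha hb =>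
      obtain ⟨m, ha⟩ := ha
      obtain ⟨n, hb⟩ := hb
      exact ⟨m + n, mul_add 2 m n ▸ SetLike.GradedMul.mul_mem ha hb⟩
  induction hx' using AddSubgroup.closure_induction with
  | mem y hy =>
    obtain ⟨n, hn⟩ := hS y hy
    exact AddSubgroup.subset_closure (Set.mem_iUnion.2 ⟨n, hn⟩)
  | zero => exact zero_mem _
  | add a b ha hb iha ihb =>
    have ha' : a ∈ evenSubring 𝒜 := Subring.mem_closure_iff.2 ha
    have hb' : b ∈ evenSubring 𝒜 := Subring.mem_closure_iff.2 hb
    exact add_mem (iha ha') (ihb hb')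
  | neg a ha iha =>
    have ha' : a ∈ evenSubring 𝒜 := Subring.mem_closure_iff.2 ha
    exact neg_mem (iha ha')

variable (hcomm : ∀ (m n : ℕ), ∀ a ∈ 𝒜 m, ∀ b ∈ 𝒜 n, a * b = (-1) ^ (m * n) * (b * a))

/-- In a graded-commutative ring, the even subring is commutative. -/
abbrev evenSubringCommRing : CommRing (evenSubring 𝒜) :=
  { (inferInstance : Ring (evenSubring 𝒜)) with
    mul_comm := (Subring.isMulCommutative_closure (s := {x | ∃ n, x ∈ 𝒜 (2 * n)}) (by
      rintro a ⟨m, ha⟩ b ⟨n, hb⟩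
      rw [hcomm _ _ a ha b hb, mul_assoc 2 m, pow_mul, neg_one_sq, one_pow,
        one_mul])).is_comm.comm }

end EvenSubring

namespace CentralAction

variable {T : Type w} [Category.{w'} T] [Preadditive T] [HasShift T ℤ]
  [∀ n : ℤ, (shiftFunctor T n).Additive]
  {H : Type v} [Ring H] {𝒜 : ℕ → AddSubgroup H} [GradedRing 𝒜]
  (act : CentralAction T 𝒜)

/-- The projection of `Ext(X, Y)` to the components of degree congruent to `p` modulo `2`. -/
def parityPart (X Y : T) (p : ℤ) : act.Ext X Y →+ act.Ext X Y :=
  DFinsupp.filterAddMonoidHom (fun n : ℤ => ShiftedHom X Y n) (fun n => n % 2 = p)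

lemma component_parityPart (X Y : T) (p n : ℤ) (x : act.Ext X Y) :
    act.component X Y n (act.parityPart X Y p x) =
      if n % 2 = p then act.component X Y n x else 0 :=
  DFinsupp.filter_apply (β := fun n : ℤ => ShiftedHom X Y n) (fun n : ℤ => n % 2 = p) n x

lemma ext_component {X Y : T} {x y : act.Ext X Y}
    (h : ∀ n, act.component X Y n x = act.component X Y n y) : x = y :=
  DFinsupp.ext (β := fun n : ℤ => ShiftedHom X Y n) h

/-- The part of `Ext^{≥ n₀}(X, Y)` in degrees congruent to `p` modulo `2`, a module over the even
subring. -/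
def parityExtGE (X Y : T) (n₀ p : ℤ) : Submodule (evenSubring 𝒜) (act.Ext X Y) where
  carrier := {x | x ∈ act.extGE X Y n₀ ∧ act.parityPart X Y p x = x}
  zero_mem' := ⟨zero_mem _, map_zero _⟩
  add_mem' := by
    rintro x y ⟨hx, hx'⟩ ⟨hy, hy'⟩
    exact ⟨add_mem hx hy, by rw [map_add, hx', hy']⟩
  smul_mem' := by
    rintro a x ⟨hx, hx'⟩
    refine ⟨Submodule.smul_mem _ (a : H) hx, ?_⟩
    change act.parityPart X Y p ((a : H) • x) = (a : H) • x
    have ha : a ∈ AddSubgroup.closure (⋃ n, (evenDegree 𝒜 n : Set (evenSubring 𝒜))) := by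
      rw [closure_iUnion_evenDegree]; trivial
    induction ha using AddSubgroup.closure_induction with
    | mem a ha =>
      obtain ⟨m, ha⟩ := Set.mem_iUnion.1 ha
      refine act.ext_component fun n => ?_
      have h1 := act.component_smul X Y (2 * m) ⟨a, ha⟩ (n - (2 * m : ℕ)) n (by ring) x
      rw [component_parityPart, h1]
      split_ifs with hn
      · rfl
      · have h2 := act.component_parityPart X Y p (n - (2 * m : ℕ)) x
        rw [if_neg (by push_cast; omega), hx'] at h2
        rw [h2, ShiftedHom.zero_comp]
    | zero => simp
    | add a b _ _ ha hb => rw [Subring.coe_add, add_smul, map_add, ha, hb]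
    | neg a _ ha => rw [Subring.coe_neg, neg_smul, map_neg, ha]

/-- Odd elements of `H` change the parity and are killed by the projection; even ones act through
the even subring. -/
lemma parityPart_smul_mem {X Y : T} {n₀ p : ℤ}
    (N : Submodule (evenSubring 𝒜) (act.Ext X Y)) (hN : N ≤ act.parityExtGE X Y n₀ p)
    (a : H) {x : act.Ext X Y} (hx : x ∈ N) : act.parityPart X Y p (a • x) ∈ N := by
  induction a using DirectSum.Decomposition.inductionOn 𝒜 with
  | zero => rw [zero_smul, map_zero]; exact zero_mem _
  | add a b ha hb => rw [add_smul, map_add]; exact add_mem ha hb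
  | homogeneous a =>
    rename_i m
    obtain ⟨k, hk | hk⟩ := Nat.even_or_odd' m
    · subst hk
      have h1 : (⟨a, mem_evenSubring 𝒜 a.2⟩ : evenSubring 𝒜) • x ∈ N := N.smul_mem _ hx
      have h2 := (hN h1).2
      change act.parityPart X Y p ((a : H) • x) = (a : H) • x at h2
      rw [h2]
      exact h1
    · suffices act.parityPart X Y p ((a : H) • x) = 0 by rw [this]; exact zero_mem _
      refine act.ext_component fun n => ?_
      rw [map_zero, component_parityPart]
      split_ifs with hn
      · rw [act.component_smul X Y m a (n - m) n (by ring)]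
        have h2 := act.component_parityPart X Y p (n - m) x
        rw [if_neg (by rw [hk]; push_cast; omega), (hN hx).2] at h2
        rw [h2, ShiftedHom.zero_comp]
      · rfl

/-- Sending a submodule over the even subring to its `H`-span is strictly monotone, because the
parity projection recovers the submodule from the span. Ascending chains therefore stabilize. -/
lemma isNoetherian_parityExtGE {X Y : T} {n₀ : ℤ} (p : ℤ)
    (h : IsNoetherian H (act.extGE X Y n₀)) :
    IsNoetherian (evenSubring 𝒜) (act.parityExtGE X Y n₀ p) := by
  let Φ : Submodule (evenSubring 𝒜) (act.parityExtGE X Y n₀ p) →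
      Submodule H (act.extGE X Y n₀) := fun N =>
    Submodule.span H {y | (y : act.Ext X Y) ∈ N.map (Submodule.subtype _)}
  have hmem : ∀ N : Submodule (evenSubring 𝒜) (act.parityExtGE X Y n₀ p), ∀ y ∈ Φ N, ∀ a : H,
      act.parityPart X Y p (a • (y : act.Ext X Y)) ∈ N.map (Submodule.subtype _) := by
    intro N y hy
    induction hy using Submodule.span_induction with
    | mem y hy => exact fun a => act.parityPart_smul_mem _ (Submodule.map_subtype_le _ _) a hy
    | zero => intro a; rw [Submodule.coe_zero, smul_zero, map_zero]; exact zero_mem _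
    | add x y _ _ hx hy =>
      intro a
      rw [Submodule.coe_add, smul_add, map_add]
      exact add_mem (hx a) (hy a)
    | smul b x _ hx => intro a; rw [Submodule.coe_smul, smul_smul]; exact hx _
  have hle : ∀ N N', Φ N ≤ Φ N' → N ≤ N' := by
    intro N N' hNN' x hx
    have hx1 : (⟨x, x.2.1⟩ : act.extGE X Y n₀) ∈ Φ N := Submodule.subset_span ⟨x, hx, rfl⟩
    have hx2 := hmem N' _ (hNN' hx1) 1
    rw [one_smul] at hx2
    obtain ⟨y, hy, hyx⟩ := hx2
    have : y = x := Subtype.ext (hyx.trans x.2.2)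
    rwa [← this]
  have hmono : StrictMono Φ := by
    refine Monotone.strictMono_of_injective (fun N N' hN => Submodule.span_mono ?_)
      fun N N' hN => le_antisymm (hle _ _ hN.le) (hle _ _ hN.ge)
    exact fun y hy => Submodule.map_mono hN hy
  have := isNoetherian_iff'.1 h
  exact isNoetherian_iff'.2 hmono.wellFoundedGT

lemma isNoetherian_restrictScalars_extGE {X Y : T} {n₀ : ℤ}
    (h : IsNoetherian H (act.extGE X Y n₀)) :
    IsNoetherian (evenSubring 𝒜) ((act.extGE X Y n₀).restrictScalars (evenSubring 𝒜)) := by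
  have h0 := act.isNoetherian_parityExtGE 0 h
  have h1 := act.isNoetherian_parityExtGE 1 h
  have hle : (act.extGE X Y n₀).restrictScalars (evenSubring 𝒜) ≤
      act.parityExtGE X Y n₀ 0 ⊔ act.parityExtGE X Y n₀ 1 := by
    intro x hx
    have hp : ∀ p, act.parityPart X Y p x ∈ act.parityExtGE X Y n₀ p := fun p =>
      ⟨fun n hn => by rw [component_parityPart, hx n hn, ite_self], act.ext_component fun n => by
        rw [component_parityPart, component_parityPart]
        split_ifs <;> rfl⟩
    have hsum : x = act.parityPart X Y 0 x + act.parityPart X Y 1 x := by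
      refine act.ext_component fun n => ?_
      rw [map_add, component_parityPart, component_parityPart]
      rcases Int.emod_two_eq_zero_or_one n with hn | hn <;> simp [hn]
    rw [hsum]
    exact Submodule.add_mem_sup (hp 0) (hp 1)
  exact isNoetherian_of_injective (Submodule.inclusion hle) (Submodule.inclusion_injective _)

variable (hcomm : ∀ (m n : ℕ), ∀ a ∈ 𝒜 m, ∀ b ∈ 𝒜 n, a * b = (-1) ^ (m * n) * (b * a))

include hcomm in
/-- If `Ext(X, Y)` is Noetherian in large degrees, then some homogeneous element of positive degree
acts injectively on `Ext(X, Y)` in large degrees. -/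
lemma EventuallyNoetherian.exists_filterRegular {X Y : T} (h : act.EventuallyNoetherian X Y) :
    ∃ e > 0, ∃ a : 𝒜 e, ∃ b : ℤ, ∀ i ≥ b, ∀ z : ShiftedHom X Y i,
      z.comp (act.φ Y e a) rfl = 0 → z = 0 := by
  obtain ⟨n₀, h⟩ := h
  let := evenSubringCommRing 𝒜 hcomm
  have hE := act.isNoetherian_restrictScalars_extGE h
  let E := (act.extGE X Y n₀).restrictScalars (evenSubring 𝒜)
  have hmem : ∀ n (y : E), act.ofDegree X Y n (act.component X Y n y) ∈ act.extGE X Y n₀ := by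
    intro n y
    by_cases hn : n < n₀
    · rw [y.2 n hn, map_zero]; exact zero_mem _
    · exact act.ofDegree_mem_extGE X Y (by omega) _
  let π : ℤ → E →+ E := fun n => AddMonoidHom.mk'
    (fun y => ⟨act.ofDegree X Y n (act.component X Y n y), hmem n y⟩) fun x y => Subtype.ext (by
      change act.ofDegree X Y n (act.component X Y n ((x : act.Ext X Y) + y)) = _
      rw [map_add, map_add]
      rfl)
  have hπ0 : ∀ n (y : E), π n y = 0 → act.component X Y n y = 0 := by
    intro n y hy
    have hy' : act.ofDegree X Y n (act.component X Y n y) = 0 := congrArg Subtype.val hy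
    rw [← act.component_ofDegree_self X Y n (act.component X Y n y), hy', map_zero]
  -- The factor `2` records that degree `m` of the even subring is degree `2 * m` of `H`.
  obtain ⟨m, hm, a, ha, b, hb⟩ := exists_homogeneous_filterRegular (evenDegree 𝒜)
    (closure_iUnion_evenDegree 𝒜) (E := E) π 2 (by
      intro m a ha n y
      refine Subtype.ext ?_
      change act.ofDegree X Y _ (act.component X Y _ ((a : H) • (y : act.Ext X Y))) =
        (a : H) • act.ofDegree X Y n (act.component X Y n y)
      have h1 := act.component_smul X Y (2 * m) ⟨a, ha⟩ n (n + (2 : ℕ) * m) (by push_cast; ring) y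
      have h2 := act.smul_ofDegree X Y (2 * m) n (n + (2 : ℕ) * m) (by push_cast; ring) ⟨a, ha⟩
        (act.component X Y n y)
      dsimp only at h1 h2
      rw [h1, h2])
    (fun y hy => Subtype.ext (act.eq_zero_of_component X Y y fun n => hπ0 n y (hy n)))
    (fun y => by
      obtain ⟨s, -, hs⟩ := act.eq_sum_component X Y (y : act.Ext X Y)
      refine ⟨∑ i ∈ s, |i| + 1, fun n hn => Subtype.ext ?_⟩
      have hns : n ∉ s := fun hns => by
        have := Finset.single_le_sum (f := fun i : ℤ => |i|) (fun i _ => abs_nonneg i) hns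
        omega
      change act.ofDegree X Y n (act.component X Y n y) = 0
      rw [hs n hns, map_zero]) two_pos
  refine ⟨2 * m, by omega, ⟨a, ha⟩, max b n₀, fun i hi z hz => ?_⟩
  have hzE := act.ofDegree_mem_extGE X Y (le_of_max_le_right hi) z
  have := hb ⟨act.ofDegree X Y i z, hzE⟩ (Subtype.ext (by
    change (a : H) • act.ofDegree X Y i z = 0
    have h2 := act.smul_ofDegree X Y (2 * m) i _ rfl ⟨a, ha⟩ z
    dsimp only at h2
    rw [h2, hz, map_zero])) i (le_of_max_le_left hi)
  have := hπ0 _ _ this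
  rwa [act.component_ofDegree_self] at this

include hcomm in
-- By naturality, precomposing with `φ_X(a)` amounts to postcomposing with `φ(a)` on a shift of `Y`.
-- This converts injectivity of the action into injectivity of the map whose cone is taken.
lemma EventuallyNoetherian.exists_φ_comp_injective {X Y : T} (h : act.EventuallyNoetherian X Y) :
    ∃ e > 0, ∃ a : 𝒜 e, ∃ b : ℤ, ∀ i ≥ b, ∀ z : X⟦(e : ℤ)⟧ ⟶ Y⟦i⟧,
      act.φ X e a ≫ z = 0 → z = 0 := by
  obtain ⟨e, he, a, b, hb⟩ := h.exists_filterRegular act hcomm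
  -- The bound keeps `j = i - e` nonnegative, as `exists_iso_φ_shift` requires, and at least `b`.
  refine ⟨e, he, a, max b 0 + e, fun i hi z hz => ?_⟩
  obtain ⟨j, hj⟩ : ∃ j : ℕ, (j : ℤ) = i - e := ⟨(i - e).toNat, by omega⟩
  let α := (shiftFunctorAdd' T (j : ℤ) e i (by omega)).app Y
  obtain ⟨w, hw⟩ := (shiftFunctor T (e : ℤ)).map_surjective (X := X) (Y := Y⟦(j : ℤ)⟧) (z ≫ α.hom)
  obtain ⟨β, hβ⟩ := act.exists_iso_φ_shift Y e a j
  have h1 := act.φ_naturality w e a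
  have hw0 : w = 0 := by
    refine hb j (by omega) w ?_
    rw [hw, reassoc_of% hz, Limits.zero_comp, hβ, ← Category.assoc,
      Preadditive.IsIso.comp_right_eq_zero] at h1
    rw [ShiftedHom.comp, reassoc_of% h1, Limits.zero_comp]
  rwa [hw0, Functor.map_zero, eq_comm, Preadditive.IsIso.comp_right_eq_zero] at hw

end CentralAction

end

noncomputable section

/-! ### Lengths of Hom modules in a triangle -/

section HomLength

open Pretriangulated Limits

variable (A : Type v) [CommRing A] {T : Type w} [Category.{w'} T] [Preadditive T] [Linear A T]
  [HasShift T ℤ]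

/-- The length of `Hom(D, Σⁿ S)` as an `A`-module. -/
def homLength (S D : T) (n : ℤ) : ℕ∞ := Module.length A (D ⟶ S⟦n⟧)

variable {A} in
lemma homLength_eq_zero_iff {S D : T} {n : ℤ} :
    homLength A S D n = 0 ↔ ∀ x : D ⟶ S⟦n⟧, x = 0 := by
  rw [homLength, Module.length_eq_zero_iff, subsingleton_iff_forall_eq 0]

lemma homLength_shift [∀ n : ℤ, (shiftFunctor T n).Additive]
    [∀ n : ℤ, (shiftFunctor T n).Linear A] (S D : T) (e n m : ℤ) (h : m + e = n) :
    homLength A S (D⟦e⟧) n = homLength A S D m := by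
  let α : S⟦n⟧ ≅ S⟦m⟧⟦e⟧ := (shiftFunctorAdd' T m e n h).app S
  exact ((Linear.homCongr A (Iso.refl (D⟦e⟧)) α).trans (LinearEquiv.ofBijective
    ((shiftFunctor T e).mapLinearMap A (X := D) (Y := S⟦m⟧))
    ⟨(shiftFunctor T e).map_injective, (shiftFunctor T e).map_surjective⟩).symm).length_eq

lemma eq_zero_of_shift [∀ n : ℤ, (shiftFunctor T n).Additive] {S D : T} {e n m : ℤ}
    (h : m + e = n) (hD : ∀ x : D ⟶ S⟦m⟧, x = 0) (x : D⟦e⟧ ⟶ S⟦n⟧) : x = 0 := by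
  let α : S⟦n⟧ ≅ S⟦m⟧⟦e⟧ := (shiftFunctorAdd' T m e n h).app S
  obtain ⟨y, hy⟩ := (shiftFunctor T e).map_surjective (x ≫ α.hom)
  rwa [hD y, Functor.map_zero, eq_comm, Preadditive.IsIso.comp_right_eq_zero] at hy

variable [HasZeroObject T] [∀ n : ℤ, (shiftFunctor T n).Additive] [Pretriangulated T]

lemma homLength_le_of_distTriang (S : T) {X Y Z : T} {f : X ⟶ Y} {g : Y ⟶ Z} {h : Z ⟶ X⟦(1 : ℤ)⟧}
    (hT : Triangle.mk f g h ∈ distTriang T) (n : ℤ) :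
    homLength A S Y n ≤ homLength A S X n + homLength A S Z n := by
  let φ : (Z ⟶ S⟦n⟧) →ₗ[A] (Y ⟶ S⟦n⟧) := Linear.leftComp A _ g
  let ψ : (Y ⟶ S⟦n⟧) →ₗ[A] (X ⟶ S⟦n⟧) := Linear.leftComp A _ f
  have hex : LinearMap.ker ψ ≤ LinearMap.range φ := fun x hx => by
    obtain ⟨y, hy⟩ : ∃ y, x = g ≫ y := Triangle.yoneda_exact₂ _ hT x hx
    exact ⟨y, hy.symm⟩
  have h1 := Module.length_eq_add_of_exact (LinearMap.ker ψ).subtype ψ.rangeRestrict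
    (Submodule.subtype_injective _) ψ.surjective_rangeRestrict
    (by rw [LinearMap.exact_iff, LinearMap.ker_rangeRestrict, Submodule.range_subtype])
  rw [homLength, h1, add_comm]
  refine add_le_add (Module.length_le_of_injective _ (Submodule.subtype_injective _)) ?_
  exact (Module.length_le_of_injective (Submodule.inclusion hex)
    (Submodule.inclusion_injective _)).trans (Module.length_le_of_surjective φ.rangeRestrict
      φ.surjective_rangeRestrict)

variable [∀ n : ℤ, (shiftFunctor T n).Linear A]

/-- Injectivity in degree `n` embeds `Hom(Y, Σⁿ S)` in `Hom(X, Σⁿ S)`, and injectivity in degree `n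
+ 1` makes `Hom(X, Σⁿ S) → Hom(Z, Σⁿ⁺¹ S)` surjective. The composite is zero, which already gives
the inequality. -/
lemma homLength_add_le_of_distTriang (S : T) {X Y Z : T} {f : X ⟶ Y} {g : Y ⟶ Z}
    {h : Z ⟶ X⟦(1 : ℤ)⟧} (hT : Triangle.mk f g h ∈ distTriang T) (n : ℤ)
    (hn : ∀ x : Y ⟶ S⟦n⟧, f ≫ x = 0 → x = 0) (hn' : ∀ x : Y ⟶ S⟦n + 1⟧, f ≫ x = 0 → x = 0) :
    homLength A S Y n + homLength A S Z (n + 1) ≤ homLength A S X n := by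
  let φ : (Y⟦(1 : ℤ)⟧ ⟶ S⟦n + 1⟧) →ₗ[A] (X⟦(1 : ℤ)⟧ ⟶ S⟦n + 1⟧) := Linear.leftComp A _ (f⟦(1 : ℤ)⟧')
  let ψ : (X⟦(1 : ℤ)⟧ ⟶ S⟦n + 1⟧) →ₗ[A] (Z ⟶ S⟦n + 1⟧) := Linear.leftComp A _ h
  let α : S⟦n + 1⟧ ≅ S⟦n⟧⟦(1 : ℤ)⟧ := (shiftFunctorAdd T n 1).app S
  have hφ : Function.Injective φ := by
    rw [← LinearMap.ker_eq_bot, LinearMap.ker_eq_bot']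
    intro x hx
    change f⟦(1 : ℤ)⟧' ≫ x = 0 at hx
    obtain ⟨y, hy⟩ := (shiftFunctor T (1 : ℤ)).map_surjective (x ≫ α.hom)
    have hy0 : y = 0 := hn y ((shiftFunctor T (1 : ℤ)).map_injective (by
      rw [Functor.map_comp, hy, reassoc_of% hx, zero_comp, Functor.map_zero]))
    rwa [hy0, Functor.map_zero, eq_comm, Preadditive.IsIso.comp_right_eq_zero] at hy
  have hψ : Function.Surjective ψ := fun x => by
    have h0 : g ≫ x = 0 := hn' _ (by
      have := comp_distTriang_mor_zero₁₂ _ hT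
      change f ≫ g = 0 at this
      rw [reassoc_of% this, zero_comp])
    obtain ⟨y, hy⟩ : ∃ y, x = h ≫ y := Triangle.yoneda_exact₃ _ hT x h0
    exact ⟨y, hy.symm⟩
  have hφψ : LinearMap.range φ ≤ LinearMap.ker ψ := by
    rintro _ ⟨x, rfl⟩
    have := comp_distTriang_mor_zero₃₁ _ hT
    change h ≫ f⟦(1 : ℤ)⟧' = 0 at this
    change h ≫ f⟦(1 : ℤ)⟧' ≫ x = 0
    rw [reassoc_of% this, zero_comp]
  have h1 := Module.length_eq_add_of_exact (LinearMap.ker ψ).subtype ψ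
    (Submodule.subtype_injective _) hψ
    (by rw [LinearMap.exact_iff, Submodule.range_subtype])
  rw [← homLength_shift A S Y 1 (n + 1) n rfl, ← homLength_shift A S X 1 (n + 1) n rfl, homLength,
    homLength, homLength, h1]
  refine add_le_add ?_ le_rfl
  exact Module.length_le_of_injective (φ.codRestrict _ fun x => hφψ ⟨x, rfl⟩)
    ((LinearMap.injective_codRestrict_iff _).2 hφ)

end HomLength

/-! ### Maps from a complex to a shifted object -/

section SingleHom

open CochainComplex HomComplex

variable {𝒞 : Type w} [Category.{w'} 𝒞] [Preadditive 𝒞]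

/-- The morphism in the homotopy category given by a cocycle `K ⟶ Σⁿ L`. -/
def homOfCocycle {K L : CochainComplex 𝒞 ℤ} {n : ℤ} (z : Cocycle K L n) :
    (HomotopyCategory.quotient 𝒞 _).obj K ⟶ ((HomotopyCategory.quotient 𝒞 _).obj L)⟦n⟧ :=
  (HomotopyCategory.quotient 𝒞 _).map (Cocycle.equivHomShift.symm z) ≫
    (((HomotopyCategory.quotient 𝒞 (.up ℤ)).commShiftIso n).hom.app L)

lemma homOfCocycle_surjective {K L : CochainComplex 𝒞 ℤ} {n : ℤ} :
    Function.Surjective (homOfCocycle (K := K) (L := L) (n := n)) := by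
  intro x
  obtain ⟨y, hy⟩ := (CohomologyClass.toHom_bijective K L n).2
    (x ≫ ((HomotopyCategory.quotient 𝒞 (.up ℤ)).commShiftIso n).inv.app L)
  obtain ⟨z, rfl⟩ := y.mk_surjective
  refine ⟨z, ?_⟩
  rw [CohomologyClass.toHom_mk] at hy
  rw [homOfCocycle, hy, Category.assoc, Iso.inv_hom_id_app]
  exact Category.comp_id _

lemma homOfCocycle_eq_zero_iff {K L : CochainComplex 𝒞 ℤ} {n : ℤ} (z : Cocycle K L n) :
    homOfCocycle z = 0 ↔ z ∈ coboundaries K L n := by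
  rw [homOfCocycle, Preadditive.IsIso.comp_right_eq_zero, ← CohomologyClass.toHom_mk,
    CohomologyClass.toHom_mk_eq_zero_iff]

lemma homOfCocycle_add {K L : CochainComplex 𝒞 ℤ} {n : ℤ} (z z' : Cocycle K L n) :
    homOfCocycle (z + z') = homOfCocycle z + homOfCocycle z' := by
  simp only [homOfCocycle, map_add, Functor.map_add, Preadditive.add_comp]

lemma homOfCocycle_postcomp {K L L' : CochainComplex 𝒞 ℤ} {n : ℤ} (z : Cocycle K L n)
    (f : L ⟶ L') : homOfCocycle (z.postcomp f) =
      homOfCocycle z ≫ ((HomotopyCategory.quotient 𝒞 _).map f)⟦n⟧' := by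
  have h : Cocycle.equivHomShift.symm (z.postcomp f) = Cocycle.equivHomShift.symm z ≫ f⟦n⟧' :=
    Cocycle.equivHomShift_symm_postcomp z f
  have h2 := ((HomotopyCategory.quotient 𝒞 (.up ℤ)).commShiftIso n).hom.naturality f
  simp only [Functor.comp_map] at h2
  rw [homOfCocycle, homOfCocycle, h, Functor.map_comp, Category.assoc, Category.assoc, h2]

/-- Morphisms from a complex to a shift of an object concentrated in degree `0` all vanish iff the
corresponding sequence of abelian groups is exact. -/
lemma forall_hom_single_eq_zero_iff [Limits.HasZeroObject 𝒞] (L : CochainComplex 𝒞 ℤ) (N : 𝒞) {n p' p p'' : ℤ}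
    (hn : p + n = 0) (hp' : p' + 1 = p) (hp'' : p + 1 = p'') :
    (∀ x : (HomotopyCategory.quotient 𝒞 _).obj L ⟶
      ((HomotopyCategory.singleFunctor 𝒞 0).obj N)⟦n⟧, x = 0) ↔
    ∀ f : L.X p ⟶ N, L.d p' p ≫ f = 0 → ∃ g : L.X p'' ⟶ N, L.d p p'' ≫ g = f := by
  constructor
  · intro h f hf
    exact (Cocycle.toSingleMk_mem_coboundaries_iff f hn p' hp' hf p'' hp'').1
      ((homOfCocycle_eq_zero_iff _).1 (h _))
  · intro h x
    obtain ⟨z, rfl⟩ := homOfCocycle_surjective x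
    obtain ⟨f, hf, rfl⟩ := Cocycle.toSingleMk_surjective z p hn p' hp'
    exact (homOfCocycle_eq_zero_iff _).2
      ((Cocycle.toSingleMk_mem_coboundaries_iff f hn p' hp' hf p'' hp'').2 (h f hf))

end SingleHom

end

noncomputable section

open Pretriangulated

/-! ### Finitely generated projective modules -/

section Projectives

variable {A : Type u} [CommRing A] [IsNoetherianRing A]

lemma FGModuleCat.module_projective (N : FGModuleCat.{u} A) [Projective N] :
    Module.Projective A N := by
  obtain ⟨r, f, hf⟩ := Module.Finite.exists_fin' A N
  let e : ULift.{u} (Fin r → A) ≃ₗ[A] (Fin r → A) := ULift.moduleEquiv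
  let p : FGModuleCat.of A (ULift.{u} (Fin r → A)) ⟶ N := FGModuleCat.ofHom (f ∘ₗ e.toLinearMap)
  have hp : Function.Surjective (f ∘ₗ e.toLinearMap) := hf.comp e.surjective
  have hp' : Epi p := by
    have : Epi ((forget₂ (FGModuleCat.{u} A) (ModuleCat.{u} A)).map p) :=
      (ModuleCat.epi_iff_surjective _).2 hp
    exact (forget₂ (FGModuleCat.{u} A) (ModuleCat.{u} A)).epi_of_epi_map this
  refine Module.Projective.of_split (Projective.factorThru (𝟙 N) p).hom.hom
    (f ∘ₗ e.toLinearMap) ?_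
  have := Projective.factorThru_comp (𝟙 N) p
  exact congrArg (fun g => g.hom.hom) this

/-- A morphism that vanishes on the image of `a` and that extends along `b` after composition with
every linear form extends along `b`, if its target is projective. -/
lemma exists_extension_of_projective {X' X X'' N : FGModuleCat.{u} A} [Projective N]
    (a : X' ⟶ X) (b : X ⟶ X'')
    (h : ∀ f : X ⟶ FGModuleCat.of A A, a ≫ f = 0 → ∃ g, b ≫ g = f) (f : X ⟶ N)
    (hf : a ≫ f = 0) : ∃ g, b ≫ g = f := by
  have := N.module_projective
  obtain ⟨r, π, s, -, hs, h1⟩ := Module.Finite.exists_comp_eq_id_of_projective A N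
  have hk : ∀ k : Fin r, ∃ g : X'' ⟶ FGModuleCat.of A A,
      b ≫ g = f ≫ FGModuleCat.ofHom ((LinearMap.proj k).comp s) := fun k =>
    h _ (by rw [reassoc_of% hf, Limits.zero_comp])
  choose g hg using hk
  refine ⟨FGModuleCat.ofHom (π.comp (LinearMap.pi fun k => (g k).hom.hom)), ?_⟩
  ext x
  have hx : (LinearMap.pi fun k => (g k).hom.hom) (b.hom.hom x) = s (f.hom.hom x) :=
    funext fun k => congrArg (fun u => u.hom.hom x) (hg k)
  change π ((LinearMap.pi fun k => (g k).hom.hom) (b.hom.hom x)) = f.hom.hom x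
  rw [hx]
  exact LinearMap.congr_fun h1 _

end Projectives

/-! ### Lifting from the residue field -/

section LocalExtension

variable {A : Type u} [CommRing A] [IsLocalRing A]

/-- Let `P ⟶ Q` be a map of finitely generated free modules with cokernel `Q ⟶ N`, such that
every map from the cokernel of `P' ⟶ P` to the residue field extends to `Q`. Then every linear map
`N ⟶ k` lifts to a linear form on `N`. -/
lemma exists_lift_to_ring {P' P Q : Type u} [AddCommGroup P'] [AddCommGroup P] [AddCommGroup Q]
    [Module A P'] [Module A P] [Module A Q] [Module.Finite A P] [Module.Finite A Q]
    [Module.Free A Q] (a : P' →ₗ[A] P) (b : P →ₗ[A] Q) (hab : b ∘ₗ a = 0)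
    (h : ∀ f : P →ₗ[A] IsLocalRing.ResidueField A, f ∘ₗ a = 0 →
      ∃ g : Q →ₗ[A] IsLocalRing.ResidueField A, g ∘ₗ b = f)
    (f : Q →ₗ[A] IsLocalRing.ResidueField A) (hf : f ∘ₗ b = 0) :
    ∃ g : Q →ₗ[A] A, g ∘ₗ b = 0 ∧ (Algebra.linearMap A (IsLocalRing.ResidueField A)) ∘ₗ g = f := by
  let k := IsLocalRing.ResidueField A
  let M := P ⧸ LinearMap.range a
  let c : M →ₗ[A] Q := (LinearMap.range a).liftQ b (by rwa [LinearMap.range_le_ker_iff])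
  have hc : c ∘ₗ (LinearMap.range a).mkQ = b := Submodule.liftQ_mkQ _ _ _
  let N := Q ⧸ LinearMap.range b
  have hrange : LinearMap.range c = LinearMap.range b := Submodule.range_liftQ _ _ _
  -- Linear forms on `k ⊗ M` separate points, and by `h` each of them factors through `k ⊗ Q`.
  have hinj : Function.Injective (LinearMap.lTensor k c) := by
    have hinj' : Function.Injective (c.baseChange k) := by
      rw [← LinearMap.ker_eq_bot, LinearMap.ker_eq_bot']
      refine fun t ht => (Module.forall_dual_apply_eq_zero_iff k t).1 fun φ => ?_
      obtain ⟨φ', rfl⟩ := (LinearMap.liftBaseChangeEquiv k).surjective φ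
      obtain ⟨g, hg⟩ := h (φ' ∘ₗ (LinearMap.range a).mkQ) (by
        rw [LinearMap.comp_assoc, LinearMap.range_mkQ_comp, LinearMap.comp_zero])
      have hg' : g ∘ₗ c = φ' := by
        apply Submodule.linearMap_qext
        rw [LinearMap.comp_assoc, hc, hg]
      have hφ : LinearMap.liftBaseChangeEquiv k φ' =
          LinearMap.liftBaseChangeEquiv k g ∘ₗ c.baseChange k := by
        ext x
        simp [← hg']
      rw [hφ, LinearMap.comp_apply, ht, map_zero]
    exact hinj'
  -- A map into a free module that is injective modulo the maximal ideal has free cokernel; freeness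
  -- of `N` then lifts `f` along `A → k`.
  have hfree : Module.Free A N :=
    Module.free_of_lTensor_residueField_injective c (LinearMap.range b).mkQ
      (Submodule.mkQ_surjective _) (by
        rw [LinearMap.exact_iff, Submodule.ker_mkQ, hrange]) hinj
  obtain ⟨g, hg⟩ := Module.projective_lifting_property (Algebra.linearMap A k)
    ((LinearMap.range b).liftQ f (by rwa [LinearMap.range_le_ker_iff]))
    IsLocalRing.residue_surjective
  refine ⟨g ∘ₗ (LinearMap.range b).mkQ, ?_, ?_⟩
  · rw [LinearMap.comp_assoc, LinearMap.range_mkQ_comp, LinearMap.comp_zero]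
  · rw [← LinearMap.comp_assoc, hg, Submodule.liftQ_mkQ]

end LocalExtension

end

noncomputable section

open Pretriangulated Limits

/-! ### Eventual vanishing of maps to shifts of an object -/

section Negligible

variable {T : Type w} [Category.{w'} T] [Preadditive T] [HasShift T ℤ] [HasZeroObject T]
  [∀ n : ℤ, (shiftFunctor T n).Additive] [Pretriangulated T]

lemma forall_hom_eq_zero_of_iso {C D E : T} (e : C ≅ D) (h : ∀ x : C ⟶ E, x = 0) (x : D ⟶ E) :
    x = 0 := by
  rw [← Preadditive.IsIso.comp_left_eq_zero e.hom]
  exact h _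

/-- The objects `Y` such that `Hom(Y, Σⁱ S)` vanishes for all large `i`. -/
def eventuallyHomZero (S : T) : ObjectProperty T :=
  fun Y => ∃ i₀ : ℤ, ∀ i ≥ i₀, ∀ x : Y ⟶ S⟦i⟧, x = 0

instance (S : T) : (eventuallyHomZero S).IsClosedUnderIsomorphisms where
  of_iso := by
    rintro X Y e ⟨i₀, h⟩
    exact ⟨i₀, fun i hi => forall_hom_eq_zero_of_iso e (h i hi)⟩

instance (S : T) : (eventuallyHomZero S).IsStableUnderShift ℤ where
  isStableUnderShiftBy n := ⟨by
    rintro X ⟨i₀, h⟩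
    exact ⟨i₀ + n, fun i hi => eq_zero_of_shift (m := i - n) (by ring) (h _ (by omega))⟩⟩

instance (S : T) : (eventuallyHomZero S).IsTriangulatedClosed₂ :=
  .mk' (by
    rintro t ht ⟨i₁, h₁⟩ ⟨i₃, h₃⟩
    refine ⟨max i₁ i₃, fun i hi x => ?_⟩
    obtain ⟨y, rfl⟩ := Triangle.yoneda_exact₂ t ht x (h₁ i (le_of_max_le_left hi) _)
    rw [h₃ i (le_of_max_le_right hi) y, comp_zero])

instance (S : T) : (eventuallyHomZero S).ContainsZero where
  exists_zero := by
    obtain ⟨Z, hZ⟩ := HasZeroObject.zero (C := T)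
    exact ⟨Z, hZ, 0, fun _ _ x => hZ.eq_of_src x 0⟩

instance (S : T) : (eventuallyHomZero S).IsTriangulated where

end Negligible

/-! ### Complexes of projectives with exact dual -/

section DualExact

variable (A : Type u) [CommRing A] [IsNoetherianRing A]

/-- The homotopy category of complexes of finitely generated modules. -/
abbrev KFG : Type (u + 1) := HomotopyCategory (FGModuleCat.{u} A) (ComplexShape.up ℤ)

variable {A} in
/-- A finitely generated module, as a complex concentrated in degree `0`. -/
abbrev KFG.single (N : FGModuleCat.{u} A) : KFG A := (HomotopyCategory.singleFunctor _ 0).obj N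

/-- The complexes of projective modules `L` with `Hom(L, A)` exact, up to homotopy. -/
def dualExact : ObjectProperty (KFG A) := fun D =>
  (∃ L : CochainComplex (FGModuleCat.{u} A) ℤ, (∀ i, Projective (L.X i)) ∧
    Nonempty ((HomotopyCategory.quotient _ _).obj L ≅ D)) ∧
  ∀ (n : ℤ) (x : D ⟶ (KFG.single (FGModuleCat.of A A))⟦n⟧), x = 0

instance : (dualExact A).IsStableUnderShift ℤ where
  isStableUnderShiftBy n := ⟨by
    rintro D ⟨⟨L, hL, ⟨e⟩⟩, h⟩
    refine ⟨⟨L⟦n⟧, fun i => hL (i + n), ⟨?_⟩⟩, fun i =>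
      eq_zero_of_shift (m := i - n) (by ring) (h _)⟩
    exact ((HomotopyCategory.quotient _ (.up ℤ)).commShiftIso n).app L ≪≫
      (shiftFunctor (KFG A) n).mapIso e⟩

variable {A}

lemma projective_mappingCone_X {K L : CochainComplex (FGModuleCat.{u} A) ℤ} (f : K ⟶ L)
    (hK : ∀ i, Projective (K.X i)) (hL : ∀ i, Projective (L.X i)) (i : ℤ) :
    Projective ((CochainComplex.mappingCone f).X i) := by
  have := hK (i + 1)
  have := hL i
  exact Projective.of_iso (HomologicalComplex.homotopyCofiber.XIsoBiprod f i (i + 1) rfl).symm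
    inferInstance

/-- The third vertex is, up to homotopy, a mapping cone of projective complexes, and the long exact
sequence handles maps to shifts of `A`. -/
lemma dualExact.cone {D D' D'' : KFG A} {f : D ⟶ D'} {g : D' ⟶ D''} {h : D'' ⟶ D⟦(1 : ℤ)⟧}
    (hT : Triangle.mk f g h ∈ distTriang (KFG A)) (hD : dualExact A D) (hD' : dualExact A D') :
    dualExact A D'' := by
  constructor
  · obtain ⟨⟨K, hK, ⟨e⟩⟩, -⟩ := hD
    obtain ⟨⟨L, hL, ⟨e'⟩⟩, -⟩ := hD'
    obtain ⟨u, hu⟩ := (HomotopyCategory.quotient _ _).map_surjective (e.hom ≫ f ≫ e'.inv)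
    refine ⟨_, projective_mappingCone_X u hK hL, ⟨Triangle.π₃.mapIso (isoTriangleOfIso₁₂ _ _
      (HomotopyCategory.mappingCone_triangleh_distinguished u) hT e e' ?_)⟩⟩
    change (HomotopyCategory.quotient _ _).map u ≫ e'.hom = e.hom ≫ f
    rw [hu, Category.assoc, Category.assoc, Iso.inv_hom_id, Category.comp_id]
  · intro n x
    have h1 := (dualExact A).le_shift (1 : ℤ) _ hD
    obtain ⟨y, hy⟩ : ∃ y, x = h ≫ y := Triangle.yoneda_exact₃ _ hT x (hD'.2 n _)
    rw [hy, h1.2 n y, comp_zero]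

lemma exists_extension_of_hom_single_eq_zero {L : CochainComplex (FGModuleCat.{u} A) ℤ}
    (h : ∀ (n : ℤ) (x : (HomotopyCategory.quotient _ _).obj L ⟶
      (KFG.single (FGModuleCat.of A A))⟦n⟧), x = 0) (N : FGModuleCat.{u} A) [Projective N]
    {p' p p'' : ℤ} (hp' : p' + 1 = p) (hp'' : p + 1 = p'') (f : L.X p ⟶ N)
    (hf : L.d p' p ≫ f = 0) : ∃ g, L.d p p'' ≫ g = f :=
  exists_extension_of_projective (L.d p' p) (L.d p p'')
    ((forall_hom_single_eq_zero_iff L _ (add_neg_cancel p) hp' hp'').1 (h _)) f hf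

/-- Descending induction on the degree: exactness of `Hom(L, k)` at one term of `L` gives exactness
at the next. A cocycle with values in `k` lifts to a cocycle with values in `A` by
`exists_lift_to_ring`; the latter is a coboundary, and its primitive is reduced to `k`. -/
lemma dualExact.hom_residueField_eq_zero [IsLocalRing A] {D : KFG A} (hD : dualExact A D) {n₀ : ℤ}
    (h : ∀ n ≥ n₀, ∀ x : D ⟶ (KFG.single (residueFieldModule A))⟦n⟧, x = 0) (n : ℤ)
    (x : D ⟶ (KFG.single (residueFieldModule A))⟦n⟧) : x = 0 := by
  obtain ⟨⟨L, hL, ⟨e⟩⟩, hD⟩ := hD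
  have hL' : ∀ (n : ℤ) (x : (HomotopyCategory.quotient _ _).obj L ⟶
      (KFG.single (FGModuleCat.of A A))⟦n⟧), x = 0 :=
    fun n => forall_hom_eq_zero_of_iso e.symm (hD n)
  have key : ∀ m : ℕ, ∀ x : (HomotopyCategory.quotient _ _).obj L ⟶
      (KFG.single (residueFieldModule A))⟦n₀ - m⟧, x = 0 := by
    intro m
    induction m with
    | zero => exact fun x => forall_hom_eq_zero_of_iso e.symm (h _ (by simp)) x
    | succ m ih =>
      obtain ⟨i, hi⟩ : ∃ i : ℤ, i = m - n₀ := ⟨_, rfl⟩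
      rw [forall_hom_single_eq_zero_iff L _ (p := i) (p' := i - 1) (p'' := i + 1) (by omega)
        (by ring) rfl] at ih
      rw [forall_hom_single_eq_zero_iff L _ (p := i + 1) (p' := i) (p'' := i + 1 + 1)
        (by push_cast; omega) rfl rfl]
      intro f hf
      have := hL (i + 1)
      have := (L.X (i + 1)).module_projective
      have : Module.Free A (L.X (i + 1)) := Module.free_of_flat_of_isLocalRing
      obtain ⟨g, hg, hgf⟩ := exists_lift_to_ring (L.d (i - 1) i).hom.hom (L.d i (i + 1)).hom.hom
        (congrArg (fun u => u.hom.hom) (L.d_comp_d (i - 1) i (i + 1)))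
        (fun f hf => by
          obtain ⟨g, hg⟩ := ih (FGModuleCat.ofHom f) (by ext x; exact LinearMap.congr_fun hf x)
          exact ⟨g.hom.hom, congrArg (fun u => u.hom.hom) hg⟩)
        f.hom.hom (congrArg (fun u => u.hom.hom) hf)
      obtain ⟨g', hg'⟩ := (forall_hom_single_eq_zero_iff L _ (add_neg_cancel (i + 1)) rfl rfl).1
        (hL' _) (FGModuleCat.ofHom g) (by ext x; exact LinearMap.congr_fun hg x)
      let r : FGModuleCat.of A A ⟶ residueFieldModule A :=
        FGModuleCat.ofHom (Algebra.linearMap A (IsLocalRing.ResidueField A))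
      refine ⟨g' ≫ r, ?_⟩
      rw [reassoc_of% hg']
      ext x
      exact LinearMap.congr_fun hgf x
  by_cases hn : n₀ ≤ n
  · exact h n hn x
  · obtain ⟨m, hm⟩ : ∃ m : ℕ, n = n₀ - m := ⟨(n₀ - n).toNat, by omega⟩
    subst hm
    exact forall_hom_eq_zero_of_iso e (key m) x

end DualExact

/-! ### Null-homotopies into bounded below complexes -/

section NullHomotopy

open CochainComplex HomComplex

variable {𝒞 : Type w} [Category.{w'} 𝒞] [Preadditive 𝒞]

/-- The error of the partial homotopy in degree `m` is annihilated by the incoming differential of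
`K`, hence extends along the outgoing one. The extension is the next component of the homotopy. -/
lemma exists_single_eqUpTo {K L : CochainComplex 𝒞 ℤ}
    (f : K ⟶ L) (α : Cochain K L (-1)) (n m : ℤ) (hnm : n + 1 = m)
    (hK : ∀ u : K.X m ⟶ L.X m, K.d n m ≫ u = 0 → ∃ β : K.X (m + 1) ⟶ L.X m, K.d m (m + 1) ≫ β = u)
    (hα : (δ (-1) 0 α).EqUpTo (Cochain.ofHom f) n) :
    ∃ (h : K.X (n + 2) ⟶ L.X (n + 1)),
      (δ (-1) 0 (α + Cochain.single h (-1))).EqUpTo (Cochain.ofHom f) m := by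
  subst hnm
  let u := f.f (n + 1) - α.v (n + 1) n (by lia) ≫ L.d n (n + 1) -
    K.d (n + 1) (n + 2) ≫ α.v (n + 2) (n + 1) (by lia)
  have hu : K.d n (n + 1) ≫ u = 0 := by
    have eq := hα n n (add_zero n) (by rfl)
    simp only [δ_v (-1) 0 (neg_add_cancel 1) α n n (add_zero _) (n - 1) (n + 1)
      (by lia) (by lia), Int.negOnePow_zero, one_smul, Cochain.ofHom_v] at eq
    simp only [u, Preadditive.comp_sub, HomologicalComplex.d_comp_d_assoc, zero_comp,
      ← f.comm, ← eq, Preadditive.add_comp, Category.assoc, L.d_comp_d, comp_zero, zero_add,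
      sub_self]
  obtain ⟨β, hβ⟩ : ∃ (β : K.X (n + 2) ⟶ L.X (n + 1)), K.d (n + 1) (n + 2) ≫ β = u := by
    have h2 : n + 1 + 1 = n + 2 := by ring
    rw [← h2]
    exact hK u hu
  refine ⟨β, ?_⟩
  intro p q hpq hp
  obtain rfl : p = q := by lia
  obtain hp | rfl := hp.lt_or_eq
  · rw [δ_add, Cochain.add_v, hα p p (by lia) (by lia), add_eq_left,
      δ_v (-1) 0 (neg_add_cancel 1) _ p p hpq (p - 1) (p + 1) rfl rfl,
      Cochain.single_v_eq_zero _ _ _ _ _ (by lia),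
      Cochain.single_v_eq_zero _ _ _ _ _ (by lia)]
    simp
  · rw [δ_v (-1) 0 (neg_add_cancel 1) _ (n + 1) (n + 1) (by lia) n (n + 2)
      (by lia) (by lia), Cochain.add_v,
      Cochain.single_v_eq_zero _ _ _ _ _ (by lia)]
    simp [hβ, u]

open Cochain.InductionUp in
/-- A chain map `K ⟶ L` to a bounded below complex is null-homotopic, if the functors
`Hom(-, L.X n)` map `K` to complexes that are exact in degree `n`. -/
lemma nonempty_homotopy_zero_of_exists_extension {K L : CochainComplex 𝒞 ℤ} (d : ℤ)
    [L.IsStrictlyGE d]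
    (hK : ∀ m (u : K.X m ⟶ L.X m), K.d (m - 1) m ≫ u = 0 →
      ∃ β : K.X (m + 1) ⟶ L.X m, K.d m (m + 1) ≫ β = u) (f : K ⟶ L) :
    Nonempty (Homotopy f 0) := by
  let X (n : ℕ) : Set (Cochain K L (-1)) :=
    Set.ofPred (fun α => (δ (-1) 0 α).EqUpTo (Cochain.ofHom f) (n + d - 1))
  let x₀ : X 0 := ⟨0, fun p q hpq hp ↦
    IsZero.eq_of_tgt (L.isZero_of_isStrictlyGE d _ (by lia)) _ _⟩
  have hstep (n : ℕ) (α : X n) := exists_single_eqUpTo f α.1 (n + d - 1) ((n + 1 : ℕ) + d - 1)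
    (by lia) (by
      have h1 : (n : ℤ) + d - 1 = ((n + 1 : ℕ) + d - 1) - 1 := by push_cast; ring
      rw [h1]
      exact hK _) α.2
  let φ (n : ℕ) (α : X n) : X (n + 1) := ⟨_, (hstep n α).choose_spec⟩
  have hφ (k : ℕ) (x : X k) : (φ k x).1.EqUpTo x.1 (d + k) := fun p q hpq hp => by
    dsimp [φ]
    rw [add_eq_left, Cochain.single_v_eq_zero _ _ _ _ _ (by lia)]
  refine ⟨(Cochain.equivHomotopy f 0).symm ⟨limitSequence φ hφ x₀, ?_⟩⟩
  rw [Cochain.ofHom_zero, add_zero]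
  ext n
  let k₀ := (n - d + 1).toNat
  rw [← (sequence φ x₀ k₀).2 n n (add_zero n) (by lia),
    δ_v (-1) 0 (neg_add_cancel 1) _ n n (by lia) (n - 1) (n + 1) rfl (by lia),
    δ_v (-1) 0 (neg_add_cancel 1) _ n n (by lia) (n - 1) (n + 1) rfl (by lia),
    limitSequence_eqUpTo φ hφ x₀ k₀ n (n - 1) (by lia) (by lia),
    limitSequence_eqUpTo φ hφ x₀ k₀ (n + 1) n (by lia) (by lia)]

variable {A : Type u} [CommRing A] [IsNoetherianRing A]

/-- Exactness of `Hom(L, A)` passes to `Hom(L, N)` for finitely generated projective `N`, so a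
null-homotopy can be built upwards from the lowest degree of `Y`. -/
lemma rightOrthogonal_dualExact_of_projective (Y : CochainComplex (FGModuleCat.{u} A) ℤ) (d : ℤ)
    [Y.IsStrictlyGE d] (hY : ∀ i, Projective (Y.X i)) :
    (dualExact A).rightOrthogonal ((HomotopyCategory.quotient _ _).obj Y) := by
  rintro D x ⟨⟨L, hL, ⟨e⟩⟩, hD⟩
  refine forall_hom_eq_zero_of_iso e (fun y => ?_) x
  obtain ⟨f, rfl⟩ := (HomotopyCategory.quotient _ _).map_surjective y
  obtain ⟨h⟩ := nonempty_homotopy_zero_of_exists_extension d (fun m u hu => by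
    have := hY m
    exact exists_extension_of_hom_single_eq_zero (fun n => forall_hom_eq_zero_of_iso e.symm (hD n))
      _ (by ring) rfl u hu) f
  rw [HomotopyCategory.eq_of_homotopy _ _ h, Functor.map_zero]

end NullHomotopy

end

noncomputable section

open Pretriangulated Limits

/-! ### Complete resolutions and their cones -/

section Realization

variable {A : Type u} [CommRing A] [IsNoetherianRing A]

open DerivedCategory

lemma exists_lift_endomorphism {P : KFG A}
    (hP : (HomotopyCategory.subcategoryAcyclic (FGModuleCat.{u} A)).leftOrthogonal P) {X : Db A}
    (α : Qh.obj P ≅ Bounded.ι.obj X) {e : ℤ} (φ : X ⟶ X⟦e⟧) :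
    ∃ ψ : P ⟶ P⟦e⟧, Qh.map ψ ≫ (Qh.commShiftIso e).hom.app P ≫ α.hom⟦e⟧' =
      α.hom ≫ Bounded.ι.map φ ≫ (Bounded.ι.commShiftIso e).hom.app X := by
  obtain ⟨ψ, hψ⟩ := (hP.map_bijective_of_isTriangulated Qh (P⟦e⟧)).2
    (α.hom ≫ Bounded.ι.map φ ≫ (Bounded.ι.commShiftIso e).hom.app X ≫ α.inv⟦e⟧' ≫
      (Qh.commShiftIso e).inv.app P)
  refine ⟨ψ, ?_⟩
  rw [hψ]
  simp only [Category.assoc, Iso.inv_hom_id_app_assoc]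
  rw [← Functor.map_comp, Iso.inv_hom_id, CategoryTheory.Functor.map_id]
  congr 2
  exact Category.comp_id _

/-- Maps out of `P` in the homotopy category agree with maps in the derived category, so injectivity
of precomposition with `φ` carries over to its lift `ψ`. -/
lemma lift_injective {P : KFG A}
    (hP : (HomotopyCategory.subcategoryAcyclic (FGModuleCat.{u} A)).leftOrthogonal P) {X : Db A}
    (α : Qh.obj P ≅ Bounded.ι.obj X) {e : ℤ} {φ : X ⟶ X⟦e⟧} {ψ : P ⟶ P⟦e⟧}
    (hψ : Qh.map ψ ≫ (Qh.commShiftIso e).hom.app P ≫ α.hom⟦e⟧' =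
      α.hom ≫ Bounded.ι.map φ ≫ (Bounded.ι.commShiftIso e).hom.app X)
    (N : FGModuleCat.{u} A) (i : ℤ) (hφ : ∀ z : X⟦e⟧ ⟶ (Db.single N)⟦i⟧, φ ≫ z = 0 → z = 0)
    (y : P⟦e⟧ ⟶ (KFG.single N)⟦i⟧) (hy : ψ ≫ y = 0) : y = 0 := by
  have hP' := (HomotopyCategory.subcategoryAcyclic
    (FGModuleCat.{u} A)).leftOrthogonal.le_shift e _ hP
  let β : Bounded.ι.obj (X⟦e⟧) ≅ Qh.obj (P⟦e⟧) := (Bounded.ι.commShiftIso e).app X ≪≫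
    (shiftFunctor _ e).mapIso α.symm ≪≫ (Qh.commShiftIso e).symm.app P
  let γ : Qh.obj ((KFG.single N)⟦i⟧) ≅ Bounded.ι.obj ((Db.single N)⟦i⟧) :=
    (Qh.commShiftIso i).app (KFG.single N) ≪≫ (Bounded.ι.commShiftIso i).symm.app (Db.single N)
  have hβ : Bounded.ι.map φ ≫ β.hom = α.inv ≫ Qh.map ψ := by
    rw [← cancel_epi α.hom, Iso.hom_inv_id_assoc]
    have h1 : β.inv = (Qh.commShiftIso e).hom.app P ≫ α.hom⟦e⟧' ≫
      (Bounded.ι.commShiftIso e).inv.app X := by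
      simp [β]
    rw [← Category.assoc, ← Iso.eq_comp_inv β, h1, reassoc_of% hψ, Iso.hom_inv_id_app]
    exact (congrArg (α.hom ≫ ·) (Category.comp_id _)).symm
  obtain ⟨z, hz⟩ := Bounded.ι.map_surjective (β.hom ≫ Qh.map y ≫ γ.hom)
  have hz0 : z = 0 := hφ z (Bounded.ι.map_injective (by
    rw [Functor.map_comp, hz, reassoc_of% hβ, ← Functor.map_comp_assoc, hy, Functor.map_zero,
      Functor.map_zero, zero_comp, comp_zero]))
  rw [hz0, Functor.map_zero, eq_comm, Preadditive.IsIso.comp_left_eq_zero,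
    Preadditive.IsIso.comp_right_eq_zero] at hz
  exact (hP'.map_bijective_of_isTriangulated Qh _).1 (hz.trans (Functor.map_zero _ _ _).symm)

lemma nonempty_iso_cone {P P' : KFG A} {X X' : Db A} (α : Qh.obj P ≅ Bounded.ι.obj X) {e : ℤ}
    {φ : X ⟶ X⟦e⟧} {φ' : X⟦e⟧ ⟶ X'} {φ'' : X' ⟶ X⟦(1 : ℤ)⟧}
    (hT : Triangle.mk φ φ' φ'' ∈ distTriang (Db A))
    {ψ : P ⟶ P⟦e⟧} {ψ' : P⟦e⟧ ⟶ P'} {ψ'' : P' ⟶ P⟦(1 : ℤ)⟧}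
    (hT' : Triangle.mk ψ ψ' ψ'' ∈ distTriang (KFG A))
    (hψ : Qh.map ψ ≫ (Qh.commShiftIso e).hom.app P ≫ α.hom⟦e⟧' =
      α.hom ≫ Bounded.ι.map φ ≫ (Bounded.ι.commShiftIso e).hom.app X) :
    Nonempty (Qh.obj P' ≅ Bounded.ι.obj X') := by
  let β : Qh.obj (P⟦e⟧) ≅ Bounded.ι.obj (X⟦e⟧) := (Qh.commShiftIso e).app P ≪≫
    (shiftFunctor _ e).mapIso α ≪≫ (Bounded.ι.commShiftIso e).symm.app X
  refine ⟨Triangle.π₃.mapIso (isoTriangleOfIso₁₂ _ _ (Qh.map_distinguished _ hT')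
    (Bounded.ι.map_distinguished _ hT) α β ?_)⟩
  change Qh.map ψ ≫ (Qh.commShiftIso e).hom.app P ≫ α.hom⟦e⟧' ≫
    (Bounded.ι.commShiftIso e).inv.app X = α.hom ≫ Bounded.ι.map φ
  rw [reassoc_of% hψ, Iso.hom_inv_id_app]
  exact congrArg (α.hom ≫ ·) (Category.comp_id _)

variable [IsLocalRing A]

variable (A) in
/-- The complexes that are right orthogonal to dual exact complexes, and have no maps to large
shifts of the residue field. -/
def negligible : ObjectProperty (KFG A) :=
  (dualExact A).rightOrthogonal ⊓ eventuallyHomZero (KFG.single (residueFieldModule A))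

instance : (negligible A).IsTriangulated := by
  unfold negligible; infer_instance

/-- `D` is a dual exact complex that agrees with a projective resolution of `X` up to negligible
complexes, with finite dimensional cohomology modulo the maximal ideal. -/
structure IsCompleteResolution (D : KFG A) (X : Db A) : Prop where
  dualExact : dualExact A D
  finite : ∀ n, homLength A (KFG.single (residueFieldModule A)) D n ≠ ⊤
  exists_map : ∃ (P : KFG A) (g : D ⟶ P),
    (HomotopyCategory.subcategoryAcyclic (FGModuleCat.{u} A)).leftOrthogonal P ∧
    Nonempty (Qh.obj P ≅ Bounded.ι.obj X) ∧ (negligible A).trW g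

/-- The morphism `φ` lifts first to `ψ` on the projective resolution `P`, then to `F` on `D`.
Negligible complexes form a triangulated subcategory, so the induced map from the cone of `F` to the
cone of `ψ` still has a negligible cone. -/
lemma IsCompleteResolution.cone {D : KFG A} {X X' : Db A} (hD : IsCompleteResolution D X) {e : ℤ}
    {φ : X ⟶ X⟦e⟧} {φ' : X⟦e⟧ ⟶ X'} {φ'' : X' ⟶ X⟦(1 : ℤ)⟧}
    (hT : Triangle.mk φ φ' φ'' ∈ distTriang (Db A)) {b : ℤ}
    (hφ : ∀ i ≥ b, ∀ z : X⟦e⟧ ⟶ (Db.single (residueFieldModule A))⟦i⟧, φ ≫ z = 0 → z = 0) :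
    ∃ (D' : KFG A) (F : D ⟶ D⟦e⟧) (G : D⟦e⟧ ⟶ D') (H : D' ⟶ D⟦(1 : ℤ)⟧),
      Triangle.mk F G H ∈ distTriang (KFG A) ∧ IsCompleteResolution D' X' ∧
      ∃ b' : ℤ, ∀ i ≥ b', ∀ x : D⟦e⟧ ⟶ (KFG.single (residueFieldModule A))⟦i⟧, F ≫ x = 0 → x = 0 := by
  obtain ⟨hD, hfin, P, g, hP, ⟨α⟩, hg⟩ := hD
  obtain ⟨ψ, hψ⟩ := exists_lift_endomorphism hP α φ
  obtain ⟨Y, v, w, hY, hYn⟩ := hg.shift e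
  -- The obstruction to lifting is a map from `D` to a negligible complex, which vanishes by
  -- orthogonality.
  obtain ⟨F, hF⟩ : ∃ F : D ⟶ D⟦e⟧, g ≫ ψ = F ≫ g⟦e⟧' :=
    Triangle.coyoneda_exact₂ _ hY (g ≫ ψ) (hYn.1 _ hD)
  obtain ⟨D', G, H, hD'⟩ := distinguished_cocone_triangle F
  obtain ⟨P', ψ', ψ'', hP'⟩ := distinguished_cocone_triangle ψ
  obtain ⟨g', hg', -, -⟩ := (negligible A).trW.compatible_with_triangulation _ _ hD' hP' g
    (g⟦e⟧') hg (hg.shift e) hF.symm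
  refine ⟨D', F, G, H, hD', ⟨hD.cone hD' ((_root_.dualExact A).le_shift e _ hD), fun n => ?_, P', g', ?_,
    nonempty_iso_cone α hT hP' hψ, hg'⟩, ?_⟩
  · refine ne_top_of_le_ne_top ?_ (homLength_le_of_distTriang A _ (rot_of_distTriang _ hD') n)
    exact WithTop.add_ne_top.2 ⟨(homLength_shift A _ D e n (n - e) (by ring)).trans_ne (hfin _),
      (homLength_shift A _ D 1 n (n - 1) (by ring)).trans_ne (hfin _)⟩
  · exact ObjectProperty.ext_of_isTriangulatedClosed₃ _ _ hP' hP
      (ObjectProperty.le_shift _ e _ hP)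
  -- In large degrees, maps to `Σⁱ k` from `D⟦e⟧` extend along the shift of `g` to `P⟦e⟧`, and maps
  -- from `P` are detected on `D`. Injectivity for `F` is thereby reduced to injectivity for `ψ`.
  · obtain ⟨Z, u, t, hZ, hZn⟩ := (ObjectProperty.trW_iff' _ _).1 (hg.shift e)
    obtain ⟨W, v', w', hW, hWn⟩ := hg
    obtain ⟨b₁, hb₁⟩ := hZn.2
    obtain ⟨b₂, hb₂⟩ := hWn.2
    refine ⟨max b (max b₁ b₂), fun i hi x hx => ?_⟩
    simp only [ge_iff_le, max_le_iff] at hi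
    obtain ⟨y, rfl⟩ : ∃ y, x = g⟦e⟧' ≫ y := Triangle.yoneda_exact₂ _ hZ x (hb₁ i hi.2.1 _)
    rw [← Category.assoc, ← hF, Category.assoc] at hx
    obtain ⟨z, hz⟩ : ∃ z, ψ ≫ y = v' ≫ z := Triangle.yoneda_exact₂ _ hW _ hx
    rw [hb₂ i hi.2.2 z, comp_zero] at hz
    rw [lift_injective hP α hψ _ i (hφ i hi.1) y hz, comp_zero]

end Realization

/-! ### The growth dichotomy -/

section Dichotomy

variable {A : Type u} [CommRing A] [IsNoetherianRing A] [IsLocalRing A]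
  {H : Type v} [Ring H] {𝒜 : ℕ → AddSubgroup H} [GradedRing 𝒜]
  (hcomm : ∀ (m n : ℕ), ∀ a ∈ 𝒜 m, ∀ b ∈ 𝒜 n, a * b = (-1) ^ (m * n) * (b * a))
  (act : CentralAction (Db A) 𝒜)

variable (A) in
/-- The length of the cohomology of a complex modulo the maximal ideal, as a natural number. -/
def residueLength (D : KFG A) (n : ℤ) : ℕ :=
  (homLength A (KFG.single (residueFieldModule A)) D n).toNat

include hcomm in
lemma IsCompleteResolution.exists_cone {D : KFG A} {X : Db A} (hD : IsCompleteResolution D X)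
    (hX : act.EventuallyNoetherian X (Db.single (residueFieldModule A))) :
    ∃ e > 0, ∃ (D' : KFG A) (X' : Db A) (i₀ : ℤ), IsCompleteResolution D' X' ∧
      act.EventuallyNoetherian X' (Db.single (residueFieldModule A)) ∧
      (∀ i ≥ i₀, residueLength A D i + residueLength A D' (i + 1 + (e : ℕ)) ≤
        residueLength A D (i + e)) ∧
      ∀ i, residueLength A D (i - e) ≤ residueLength A D i + residueLength A D' i := by
  obtain ⟨e, he, a, b, hb⟩ := hX.exists_φ_comp_injective act hcomm
  obtain ⟨X', φ', φ'', hT⟩ := distinguished_cocone_triangle (act.φ X e a)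
  obtain ⟨D', F, G, K, hT', hD', b', hb'⟩ := hD.cone hT hb
  refine ⟨e, he, D', X', b' - e, hD', hX.cone act hT, fun i hi => ?_, fun i => ?_⟩
  · have h1 := homLength_add_le_of_distTriang A (KFG.single (residueFieldModule A)) hT' (i + e)
      (hb' _ (by omega)) (hb' _ (by omega))
    rw [homLength_shift A _ D e (i + e) i rfl, add_right_comm i (e : ℤ) 1] at h1
    rw [residueLength, residueLength, ← ENat.toNat_add (hD.finite _) (hD'.finite _)]
    exact ENat.toNat_le_toNat h1 (hD.finite _)
  · have h1 := homLength_le_of_distTriang A (KFG.single (residueFieldModule A)) hT' i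
    rw [homLength_shift A _ D e i (i - e) (by ring)] at h1
    rw [residueLength, residueLength, residueLength, ← ENat.toNat_add (hD.finite _) (hD'.finite _)]
    exact ENat.toNat_le_toNat h1 (WithTop.add_ne_top.2 ⟨hD.finite _, hD'.finite _⟩)

include hcomm in
-- The object `X` varies in the induction: the claim for `t + 1` at `X` follows from the claim for
-- `t` at the cone of a filter-regular element.
lemma IsCompleteResolution.negPolyBound_or_posPolyGrowth (t : ℕ) {D : KFG A} {X : Db A}
    (hD : IsCompleteResolution D X)
    (hX : act.EventuallyNoetherian X (Db.single (residueFieldModule A))) :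
    NegPolyBound t (residueLength A D) ∨ PosPolyGrowth t (residueLength A D) := by
  induction t generalizing D X with
  | zero =>
    by_cases h0 : ∃ b : ℤ, ∀ n ≥ b, residueLength A D n = 0
    · left
      obtain ⟨b, hb⟩ := h0
      have hz := hD.dualExact.hom_residueField_eq_zero (n₀ := b) fun n hn =>
        homLength_eq_zero_iff.1 ((ENat.toNat_eq_zero.1 (hb n hn)).resolve_right (hD.finite n))
      exact ⟨0, 0, fun j _ => by simp [residueLength, homLength_eq_zero_iff.2 (hz _)]⟩
    · push Not at h0
      obtain ⟨e, he, D', X', i₀, -, -, hle, -⟩ := hD.exists_cone hcomm act hX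
      exact Or.inr (PosPolyGrowth.zero he
        (fun i hi => (Nat.le_add_right _ _).trans (hle i hi)) h0)
  | succ t ih =>
    obtain ⟨e, he, D', X', i₀, hD', hX', hle, hle'⟩ := hD.exists_cone hcomm act hX
    exact (ih hD' hX').imp (NegPolyBound.step he hle') (PosPolyGrowth.step he hle)

end Dichotomy

end

noncomputable section

open Pretriangulated Limits

/-! ### Comparison with the truncated resolution -/

section Truncation

open CochainComplex

variable {A : Type u} [CommRing A] [IsNoetherianRing A] [IsLocalRing A]

lemma negligible_of_projective (Y : CochainComplex (FGModuleCat.{u} A) ℤ) (d : ℤ)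
    [Y.IsStrictlyGE d] (hY : ∀ i, Projective (Y.X i)) :
    negligible A ((HomotopyCategory.quotient _ _).obj Y) := by
  refine ⟨rightOrthogonal_dualExact_of_projective Y d hY, 1 - d, fun i hi => ?_⟩
  rw [forall_hom_single_eq_zero_iff Y _ (neg_add_cancel i) (sub_add_cancel (-i) 1) rfl]
  exact fun f _ => ⟨0, (Y.isZero_of_isStrictlyGE d (-i) (by omega)).eq_of_src _ _⟩

/-- The map is degreewise a split epimorphism, so its kernel completes it to a distinguished
triangle. The kernel is bounded below and consists of projectives, hence is negligible. -/
lemma trW_negligible_of_epi {D P : CochainComplex (FGModuleCat.{u} A) ℤ} (g : D ⟶ P) (d : ℤ)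
    (hD : ∀ i, Projective (D.X i)) (hP : ∀ i, Projective (P.X i)) (hg : ∀ i, Epi (g.f i))
    (hg' : ∀ i < d, Mono (g.f i)) :
    (negligible A).trW ((HomotopyCategory.quotient _ _).map g) := by
  let S : ShortComplex (CochainComplex (FGModuleCat.{u} A) ℤ) :=
    ShortComplex.mk (kernel.ι g) g (kernel.condition g)
  have hepi : Epi g := HomologicalComplex.epi_of_epi_f g hg
  have hS : S.ShortExact :=
    { exact := ShortComplex.exact_of_f_is_kernel _ (kernelIsKernel g)
      mono_f := inferInstanceAs (Mono (kernel.ι g))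
      epi_g := hepi }
  have hSn : ∀ n, (S.map (HomologicalComplex.eval _ _ n)).ShortExact := fun n =>
    hS.map_of_exact _
  let σ : ∀ n, (S.map (HomologicalComplex.eval _ _ n)).Splitting := fun n =>
    haveI : Projective (S.map (HomologicalComplex.eval _ _ n)).X₃ := hP n
    (hSn n).splittingOfProjective
  have hproj : ∀ n, Projective ((kernel g).X n) := fun n => by
    have := hD n
    exact Retract.projective (Y := D.X n) ⟨_, _, (σ n).f_r⟩
  have hGE : (kernel g).IsStrictlyGE d := by
    rw [isStrictlyGE_iff]
    intro i hi
    have := hg' i hi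
    have h0 : (kernel.ι g).f i = 0 := by
      rw [← cancel_mono (g.f i), ← HomologicalComplex.comp_f, kernel.condition,
        HomologicalComplex.zero_f, zero_comp]
    have : Mono ((kernel.ι g).f i) := (hSn i).mono_f
    rw [IsZero.iff_id_eq_zero, ← cancel_mono ((kernel.ι g).f i), h0, comp_zero, comp_zero]
  exact ObjectProperty.trW.mk' _ (T := trianglehOfDegreewiseSplit S σ)
    ((HomotopyCategory.distinguished_iff_iso_trianglehOfDegreewiseSplit _).2
      ⟨S, σ, ⟨Iso.refl _⟩⟩) (negligible_of_projective (kernel g) d hproj)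

/-- The reindexed complex with `E.X (q + i)` in degree `i`. -/
def reindex (E : CochainComplex (FGModuleCat.{u} A) ℤ) (q : ℤ) :
    CochainComplex (FGModuleCat.{u} A) ℤ where
  X i := E.X (q + i)
  d i j := E.d (q + i) (q + j)
  shape i j hij := E.shape _ _ (by
    simp only [ComplexShape.up_Rel] at hij ⊢
    omega)
  d_comp_d' i j k _ _ := E.d_comp_d _ _ _

/-- The isomorphism between the restriction of a reindexed complex and its left part. -/
def restrictionToLeftPart (E : CochainComplex (FGModuleCat.{u} A) ℤ) (q : ℤ) :
    (reindex E q).restriction ComplexShape.embeddingDownNat ⟶ leftPart E q where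
  f i := (E.XIsoOfEq (show q + -(i : ℤ) = q - i by ring)).hom
  comm' i j _ := by
    change (E.XIsoOfEq _).hom ≫ E.d (q - i) (q - j) = E.d (q + -i) (q + -j) ≫ _
    rw [HomologicalComplex.XIsoOfEq_hom_comp_d, HomologicalComplex.d_comp_XIsoOfEq_hom]

instance (E : CochainComplex (FGModuleCat.{u} A) ℤ) (q : ℤ) (i : ℕ) :
    IsIso ((restrictionToLeftPart E q).f i) :=
  inferInstanceAs (IsIso (E.XIsoOfEq (show q + -(i : ℤ) = q - i by ring)).hom)

/-- The projection of a reindexed complex onto its part in nonpositive degrees. -/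
def toLeftPart (E : CochainComplex (FGModuleCat.{u} A) ℤ) (q : ℤ) :
    reindex E q ⟶ (leftPart E q).extend ComplexShape.embeddingDownNat :=
  ComplexShape.embeddingDownNat.liftExtend (restrictionToLeftPart E q) fun j hj i' hi' => by
    refine (hj.notMem (i' := i') hi' (j + 1) ?_).elim
    simp only [ComplexShape.up_Rel, ComplexShape.embeddingDownNat_f] at hi' ⊢
    omega

lemma toLeftPart_f_cases (E : CochainComplex (FGModuleCat.{u} A) ℤ) (q i : ℤ) :
    IsIso ((toLeftPart E q).f i) ∨ 1 ≤ i ∧ IsZero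
      (((leftPart E q).extend ComplexShape.embeddingDownNat).X i) := by
  by_cases hi : i ≤ 0
  · left
    obtain ⟨k, rfl⟩ := Int.exists_eq_neg_ofNat hi
    exact (ComplexShape.embeddingDownNat.isIso_liftExtend_f_iff (restrictionToLeftPart E q) _
      (i := k) rfl).2 inferInstance
  · exact Or.inr ⟨by omega, HomologicalComplex.isZero_extend_X _ _ _ fun k => by
      rw [ComplexShape.embeddingDownNat_f]; omega⟩

variable {E : CochainComplex (FGModuleCat.{u} A) ℤ} {q : ℤ} {N : FGModuleCat.{u} A}
  {ε : E.X q ⟶ N}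

lemma IsFreeAugmentation.trW_toLeftPart (h : IsFreeAugmentation E q ε) :
    (negligible A).trW ((HomotopyCategory.quotient _ _).map (toLeftPart E q)) := by
  refine trW_negligible_of_epi _ 1 (fun i => ?_) (fun i => ?_) (fun i => ?_) fun i hi => ?_
  · have := h.free (q + i)
    exact projective_of_free (E.X (q + i))
  · exact inferInstanceAs (Projective (h.resolution.cochainComplex.X i))
  · rcases toLeftPart_f_cases E q i with h1 | ⟨-, h1⟩
    · infer_instance
    · exact ⟨fun _ _ _ => h1.eq_of_src _ _⟩
  · rcases toLeftPart_f_cases E q i with h1 | ⟨h1, -⟩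
    · infer_instance
    · omega

lemma IsFreeAugmentation.nonempty_Qh_iso (h : IsFreeAugmentation E q ε) :
    Nonempty (DerivedCategory.Qh.obj ((HomotopyCategory.quotient _ _).obj
      ((leftPart E q).extend ComplexShape.embeddingDownNat)) ≅
        DerivedCategory.Bounded.ι.obj (Db.single N)) :=
  ⟨(DerivedCategory.quotientCompQhIso _).app h.resolution.cochainComplex ≪≫ asIso (DerivedCategory.Q.map h.resolution.π') ≪≫
    (DerivedCategory.quotientCompQhIso _).symm.app ((CochainComplex.singleFunctor _ 0).obj N)⟩

end Truncation

end

noncomputable section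

/-! ### Betti numbers as lengths of Hom modules -/

section ResidueLength

open CochainComplex HomComplex

variable {A : Type u} [CommRing A] [IsNoetherianRing A] [IsLocalRing A]

lemma smul_residueField_eq_zero {r : A} (hr : r ∈ IsLocalRing.maximalIdeal A)
    (z : IsLocalRing.ResidueField A) : r • z = 0 := by
  rw [Algebra.smul_def, IsLocalRing.ResidueField.algebraMap_eq,
    (IsLocalRing.residue_eq_zero_iff r).2 hr, zero_mul]

lemma length_linearMap_residueField (F : Type u) [AddCommGroup F] [Module A F] [Module.Finite A F]
    [Module.Free A F] :
    Module.length A (F →ₗ[A] IsLocalRing.ResidueField A) = Module.finrank A F := by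
  have hk : Module.length A (IsLocalRing.ResidueField A) = 1 := by
    rw [Module.length_eq_one_iff]
    exact isSimpleModule_iff_isCoatom.2
      (Ideal.isMaximal_def.1 (IsLocalRing.maximalIdeal.isMaximal A))
  rw [← ((Module.Free.chooseBasis A F).constr A).length_eq, Module.length_pi_of_fintype,
    Module.finrank_eq_card_chooseBasisIndex]
  simp [hk]

lemma length_hom_residueField (F : FGModuleCat.{u} A) [Module.Free A F] :
    Module.length A (F ⟶ residueFieldModule A) = Module.finrank A F := by
  let e : (F ⟶ residueFieldModule A) ≃ₗ[A] (F →ₗ[A] IsLocalRing.ResidueField A) :=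
    { toFun := fun f => f.hom.hom
      invFun := fun f => FGModuleCat.ofHom f
      map_add' := fun f g => rfl
      map_smul' := fun a f => rfl
      left_inv := fun f => rfl
      right_inv := fun f => rfl }
  rw [e.length_eq, length_linearMap_residueField]

/-- The morphism in the homotopy category given by a map from a term of a complex to `N`. -/
def homSingleOfHom {L : CochainComplex (FGModuleCat.{u} A) ℤ} {N : FGModuleCat.{u} A} {n : ℤ}
    (f : L.X (-n) ⟶ N) (hf : L.d (-n - 1) (-n) ≫ f = 0) :
    (HomotopyCategory.quotient _ _).obj L ⟶ (KFG.single N)⟦n⟧ :=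
  homOfCocycle (Cocycle.toSingleMk f (neg_add_cancel n) (-n - 1) (by ring) hf)

/-- Scalar multiplication is postcomposition with `a • 𝟙 N`, which reduces the claim to linearity of
functors. -/
lemma homSingleOfHom_smul {L : CochainComplex (FGModuleCat.{u} A) ℤ} {N : FGModuleCat.{u} A}
    {n : ℤ} (a : A) (f : L.X (-n) ⟶ N) (hf : L.d (-n - 1) (-n) ≫ f = 0)
    (hf' : L.d (-n - 1) (-n) ≫ (a • f) = 0) :
    homSingleOfHom (a • f) hf' = a • homSingleOfHom f hf := by
  have h1 := Cocycle.toSingleMk_postcomp f (neg_add_cancel n) (-n - 1) (by ring) hf (a • 𝟙 N)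
  have h2 := homOfCocycle_postcomp (Cocycle.toSingleMk f (neg_add_cancel n) (-n - 1)
    (by ring) hf) ((singleFunctor _ 0).map (a • 𝟙 N))
  have h3 : (HomotopyCategory.quotient (FGModuleCat.{u} A) (.up ℤ)).map
      ((singleFunctor _ 0).map (a • 𝟙 N)) = a • 𝟙 (KFG.single N) :=
    ((HomotopyCategory.singleFunctor _ 0).map_smul a (𝟙 N)).trans
      (congrArg (a • ·) ((HomotopyCategory.singleFunctor _ 0).map_id N))
  have h4 : f ≫ (a • 𝟙 N) = a • f := by rw [Linear.comp_smul, Category.comp_id]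
  have h5 : (a • 𝟙 (KFG.single N))⟦n⟧' = a • 𝟙 ((KFG.single N)⟦n⟧) := by
    rw [Functor.map_smul, CategoryTheory.Functor.map_id]
  have h6 : homSingleOfHom (f ≫ (a • 𝟙 N)) (by rw [h4]; exact hf') =
      homSingleOfHom f hf ≫ (a • 𝟙 (KFG.single N))⟦n⟧' :=
    (congrArg homOfCocycle h1).trans (h2.trans (by rw [h3]; rfl))
  simp only [h4] at h6
  rw [h6, h5, Linear.comp_smul, Category.comp_id]

/-- For a complex such that every map from its terms to `N` vanishes on boundaries, the classes of
maps to shifts of `N` are the maps from its terms. -/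
def homSingleEquiv (L : CochainComplex (FGModuleCat.{u} A) ℤ) (N : FGModuleCat.{u} A)
    (hL : ∀ i j (f : L.X j ⟶ N), L.d i j ≫ f = 0) (n : ℤ) :
    (L.X (-n) ⟶ N) ≃ₗ[A] ((HomotopyCategory.quotient _ _).obj L ⟶ (KFG.single N)⟦n⟧) :=
  let φ : (L.X (-n) ⟶ N) →ₗ[A] ((HomotopyCategory.quotient _ _).obj L ⟶ (KFG.single N)⟦n⟧) :=
    { toFun := fun f => homSingleOfHom f (hL _ _ f)
      map_add' := fun f g => (congrArg homOfCocycle (Cocycle.toSingleMk_add _ _ _ _ _ (hL _ _ f)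
        (hL _ _ g))).trans (homOfCocycle_add _ _)
      map_smul' := fun a f => homSingleOfHom_smul a f _ _ }
  LinearEquiv.ofBijective φ
    (by
      constructor
      · rw [← LinearMap.ker_eq_bot, LinearMap.ker_eq_bot']
        intro f hf
        obtain ⟨g, rfl⟩ := (Cocycle.toSingleMk_mem_coboundaries_iff f _ _ _ _ (-n + 1) rfl).1
          ((homOfCocycle_eq_zero_iff _).1 hf)
        exact hL _ _ g
      · intro x
        obtain ⟨z, rfl⟩ := homOfCocycle_surjective x
        obtain ⟨f, hf, rfl⟩ := Cocycle.toSingleMk_surjective z (-n) (neg_add_cancel n) (-n - 1)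
          (by ring)
        exact ⟨f, rfl⟩)

lemma d_comp_eq_zero_of_minimal {E : CochainComplex (FGModuleCat.{u} A) ℤ}
    (hE : IsMinimalComplex E) (i j : ℤ) (f : E.X j ⟶ residueFieldModule A) :
    E.d i j ≫ f = 0 := by
  by_cases hij : i + 1 = j
  · subst hij
    ext x
    have h1 : diffMap E i (i + 1) x ∈
        IsLocalRing.maximalIdeal A • (⊤ : Submodule A (E.X (i + 1))) := hE i ⟨x, rfl⟩
    change f.hom.hom (diffMap E i (i + 1) x) = 0
    refine Submodule.smul_induction_on h1 (fun r hr y _ => ?_) fun y z hy hz => ?_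
    · rw [map_smul]
      exact smul_residueField_eq_zero hr _
    · rw [map_add, hy, hz, add_zero]
  · rw [E.shape _ _ hij, Limits.zero_comp]

variable {E : CochainComplex (FGModuleCat.{u} A) ℤ} {q : ℤ} {N : FGModuleCat.{u} A}
  {ε : E.X q ⟶ N}

lemma IsFreeAugmentation.homLength_reindex (h : IsFreeAugmentation E q ε)
    (hE : IsMinimalComplex E) (n : ℤ) :
    homLength A (KFG.single (residueFieldModule A)) ((HomotopyCategory.quotient _ _).obj
      (reindex E q)) n = Module.finrank A (E.X (q + -n)) := by
  have := h.free (q + -n)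
  rw [homLength, ← (homSingleEquiv (reindex E q) (residueFieldModule A)
    (fun i j f => d_comp_eq_zero_of_minimal hE (q + i) (q + j) f) n).length_eq]
  exact length_hom_residueField (E.X (q + -n))

/-- The comparison map projects the complex onto its half that resolves `N`; finiteness of the
lengths comes from minimality. -/
lemma IsFreeAugmentation.isCompleteResolution (h : IsFreeAugmentation E q ε)
    (hE : IsMinimalComplex E)
    (hdual : ∀ i, Function.Exact (diffMap E i (i + 1)).dualMap (diffMap E (i - 1) i).dualMap) :
    IsCompleteResolution ((HomotopyCategory.quotient _ _).obj (reindex E q)) (Db.single N) where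
  dualExact := by
    refine ⟨⟨reindex E q, fun i => ?_, ⟨Iso.refl _⟩⟩, fun n => ?_⟩
    · have := h.free (q + i)
      exact projective_of_free (E.X (q + i))
    · rw [forall_hom_single_eq_zero_iff _ _ (neg_add_cancel n) (sub_add_cancel (-n) 1) rfl]
      intro f hf
      have h1 : ∀ i j k : ℤ, i + 1 = j → j + 1 = k →
          Function.Exact (diffMap E j k).dualMap (diffMap E i j).dualMap := by
        rintro i j k hij rfl
        obtain rfl : i = j - 1 := by omega
        exact hdual j
      obtain ⟨g, hg⟩ := (h1 (q + (-n - 1)) (q + -n) (q + (-n + 1)) (by ring) (by ring)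
        f.hom.hom).1 (congrArg (fun u => u.hom.hom) hf)
      refine ⟨FGModuleCat.ofHom g, ?_⟩
      ext x
      exact LinearMap.congr_fun hg x
  finite n := by
    rw [h.homLength_reindex hE]
    exact ENat.natCast_ne_top _
  exists_map :=
    ⟨_, _, CochainComplex.IsKProjective.leftOrthogonal h.resolution.cochainComplex,
      h.nonempty_Qh_iso, h.trW_toLeftPart⟩

end ResidueLength

/-! ### The dual complex -/

section Dual

variable {A : Type u} [CommRing A] [IsNoetherianRing A] {C : CochainComplex (FGModuleCat.{u} A) ℤ}

/-- In the dual basis, the coordinates of a transposed differential applied to `f` are the values of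
`f` on differentials of basis vectors, and these lie in the maximal ideal. -/
lemma IsMinimalComplex.dualComplex [IsLocalRing A] (hC : IsTotallyAcyclic C)
    (hmin : IsMinimalComplex C) : IsMinimalComplex (dualComplex C) := by
  have h1 : ∀ i j : ℤ, i + 1 = j → ∀ x : C.X i, diffMap C i j x ∈
      IsLocalRing.maximalIdeal A • (⊤ : Submodule A (C.X j)) := by
    rintro i j rfl x
    exact hmin i ⟨x, rfl⟩
  rintro i _ ⟨f, rfl⟩
  have := hC.free (-(i + 1))
  let f' : Module.Dual A (C.X (-i)) := f
  let b := Module.Free.chooseBasis A (C.X (-(i + 1)))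
  change (diffMap C (-(i + 1)) (-i)).dualMap f' ∈
    IsLocalRing.maximalIdeal A • (⊤ : Submodule A (Module.Dual A (C.X (-(i + 1)))))
  rw [← b.sum_dual_apply_smul_coord ((diffMap C (-(i + 1)) (-i)).dualMap f')]
  refine Submodule.sum_mem _ fun j _ => Submodule.smul_mem_smul ?_ trivial
  have h2 := Submodule.mem_map_of_mem (f := f') (h1 (-(i + 1)) (-i) (by ring) (b j))
  rw [Submodule.map_smul''] at h2
  exact Ideal.mul_le_left (J := Submodule.map f' ⊤) h2

/-- Biduality of finite free modules identifies the dual of `C^*` with `C`, which is exact. -/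
lemma IsTotallyAcyclic.exact_dual_dualComplex (hC : IsTotallyAcyclic C) (i : ℤ) :
    Function.Exact (diffMap (dualComplex C) i (i + 1)).dualMap
      (diffMap (dualComplex C) (i - 1) i).dualMap := by
  have h1 := hC.free (-i)
  have h2 := hC.free (-(i + 1))
  have h3 := hC.free (-(i - 1))
  exact Function.Exact.of_ladder_linearEquiv_of_exact (e₁ := Module.evalEquiv A (C.X (-(i + 1))))
    (e₂ := Module.evalEquiv A (C.X (-i))) (e₃ := Module.evalEquiv A (C.X (-(i - 1))))
    rfl rfl (hC.exact_of_eq (-(i + 1)) (-i) (-(i - 1)) (by ring) (by ring))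

end Dual

/-! ### One inequality between the complexities -/

section Main

variable {A : Type u} [CommRing A] [IsNoetherianRing A] [IsLocalRing A]
  {H : Type v} [Ring H] {𝒜 : ℕ → AddSubgroup H} [GradedRing 𝒜]
  (hcomm : ∀ (m n : ℕ), ∀ a ∈ 𝒜 m, ∀ b ∈ 𝒜 n, a * b = (-1) ^ (m * n) * (b * a))
  (act : CentralAction (Db A) 𝒜)

/-- The morphism in `D^b(A)` given by a homomorphism of modules. -/
def Db.singleMap {N N' : FGModuleCat.{u} A} (f : N ⟶ N') : Db.single N ⟶ Db.single N' :=
  DerivedCategory.Bounded.ι.preimage ((DerivedCategory.singleFunctor _ 0).map f)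

lemma CentralAction.EventuallyNoetherian.of_splitEpi_modules {N N' : FGModuleCat.{u} A}
    {Z : Db A} (p : N ⟶ N') (s : N' ⟶ N) (hsp : s ≫ p = 𝟙 N')
    (h : act.EventuallyNoetherian (Db.single N) Z) : act.EventuallyNoetherian (Db.single N') Z := by
  have key : ∀ {N N' : FGModuleCat.{u} A} (f : N ⟶ N'), DerivedCategory.Bounded.ι.map
      (Db.singleMap f) = (DerivedCategory.singleFunctor _ 0).map f :=
    fun f => Functor.map_preimage _ _
  refine h.of_splitEpi act (Db.singleMap p) (Db.singleMap s)
    (DerivedCategory.Bounded.ι.map_injective ?_)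
  rw [Functor.map_comp, key, key]
  refine ((DerivedCategory.singleFunctor _ 0).map_comp s p).symm.trans ?_
  rw [hsp]
  exact ((DerivedCategory.singleFunctor _ 0).map_id N').trans
    (DerivedCategory.Bounded.ι.map_id (Db.single N')).symm

include hcomm in
lemma IsFreeAugmentation.complexity_le {E : CochainComplex (FGModuleCat.{u} A) ℤ} {q : ℤ}
    {N : FGModuleCat.{u} A} {ε : E.X q ⟶ N} (h : IsFreeAugmentation E q ε)
    (hE : IsMinimalComplex E)
    (hdual : ∀ i, Function.Exact (diffMap E i (i + 1)).dualMap (diffMap E (i - 1) i).dualMap)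
    (hN : act.EventuallyNoetherian (Db.single N) (Db.single (residueFieldModule A)))
    {b : ℤ → ℕ} (s : ℤ) (hb : ∀ i, Module.finrank A (E.X (q + -i)) = b (i + s)) :
    complexity (fun n => b (-n)) ≤ complexity (fun n => b n) :=
  complexity_le_of_dichotomy s (fun i => by
    rw [residueLength, h.homLength_reindex hE, ENat.toNat_natCast, hb])
    fun t => (h.isCompleteResolution hE hdual).negPolyBound_or_posPolyGrowth hcomm act t hN

end Main

end

theorem theorem3p4 {A : Type u} [CommRing A] [IsNoetherianRing A] [IsLocalRing A]
    (C : CochainComplex (FGModuleCat.{u} A) ℤ)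
    (hC : IsTotallyAcyclic C) (hmin : IsMinimalComplex C)
    {H : Type v} [Ring H] (𝒜 : ℕ → AddSubgroup H) [GradedRing 𝒜]
    (hcomm : ∀ (m n : ℕ), ∀ a ∈ 𝒜 m, ∀ b ∈ 𝒜 n, a * b = (-1) ^ (m * n) * (b * a))
    (act : CentralAction (Db A) 𝒜)
    (hnoeth : act.NoethFl (Db.single (sumModuleOf C)) (Db.single (residueFieldModule A)))
    (hdual : CommutesWithDualization act hC) :
    posComplexity C = negComplexity C := by
  obtain ⟨n₀, hnoeth, -⟩ := hnoeth
  have hsum : act.EventuallyNoetherian (Db.single (sumModuleOf C))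
    (Db.single (residueFieldModule A)) := ⟨n₀, hnoeth⟩
  have hM : act.EventuallyNoetherian (Db.single (moduleOf C))
      (Db.single (residueFieldModule A)) :=
    hsum.of_splitEpi_modules act
      (FGModuleCat.ofHom (LinearMap.fst A (imageZero C) (Module.Dual A (imageZero C))))
      (FGModuleCat.ofHom (LinearMap.inl A (imageZero C) (Module.Dual A (imageZero C)))) rfl
  have hM' : act.EventuallyNoetherian (Db.single (dualModuleOf C))
      (Db.single (residueFieldModule A)) :=
    hsum.of_splitEpi_modules act
      (FGModuleCat.ofHom (LinearMap.snd A (imageZero C) (Module.Dual A (imageZero C))))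
      (FGModuleCat.ofHom (LinearMap.inr A (imageZero C) (Module.Dual A (imageZero C)))) rfl
  refine le_antisymm ?_ ?_
  -- The resolution of $M^*$ starts at the dual of $C_{-1}$, so its `i`-th term has the rank of
  -- $C_{-(i+1)}$; hence the shift `s = 1` and the reflected sequence `b`.
  · have := hC.isFreeAugmentation_dual.complexity_le hcomm act (hmin.dualComplex hC)
      hC.exact_dual_dualComplex hM' (b := fun i => bettiNumber C (-i)) 1 (fun i => by
        have h1 : -(-1 + -i) = -(-(i + 1)) := by ring
        have := hC.free (-(-1 + -i))
        change Module.finrank A (Module.Dual A (C.X (-(-1 + -i)))) =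
          Module.finrank A (C.X (-(-(i + 1))))
        exact (Module.finrank_linearMap_self A A _).trans (by rw [h1]))
    simp only [neg_neg] at this
    exact this
  · exact hC.isFreeAugmentation.complexity_le hcomm act hmin hC.exact_dual hM
      (b := bettiNumber C) 0 (fun i => by rw [zero_add, add_zero]; rfl)
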